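/- Let $n\ge 1$, let $s\ge 0$ be an integer, let $1\le p<\infty$, and let $\mathbb B$ be the unit ball of $\mathbb C^n$ with surface measure $\sigma$ on $\partial\mathbb B$. Let $R=\sum_j z_j\,\partial/\partial z_j$, and let $H_s^p$ be the space of holomorphic functions $f$ on $\mathbb B$ with $\|f\|_{s,p}=\bigl(\sup_{0\le r<1}\int_{\partial\mathbb B}|(I+R)^sf(r\zeta)|^p\,d\sigma(\zeta)\bigr)^{1/p}<\infty$. Let $\mathcal M_s^p$ be the algebra of multipliers of $H_s^p$, i.e. of functions $m$ on $\mathbb B$ with $mh\in H_s^p$ for all $h\in H_s^p$, with the operator norm. A family $S$ of points of $\mathbb B$ is interpolating for $\mathcal M_s^p$ with constant $C>0$ if for every $\lambda\in\ell^\infty(S)$ there is $m\in\mathcal M_s^p$ with $m(a)=\lambda_a$ for all $a\in S$ and $\|m\|_{\mathcal M_s^p}\le C\|\lambda\|_\infty$. It is interpolating for $H_s^p$ with constant $K$ if for every $\lambda\in\ell^p(S)$ there is $f\in H_s^p$ with $f(a)=\lambda_a(1-|a|^2)^{s-n/p}$ for all $a\in S$ and $\|f\|_{s,p}\le K\|\lambda\|_p$;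 it has a bounded linear extension operator of norm at most $K$ if such an $f$ can be chosen linearly in $\lambda$. For $a\in\mathbb B$ let $k_a(z)=(1-\bar a\cdot z)^{-(n-2s)}$ if $n\ne 2s$, and $k_a(z)=1+\log\frac1{1-\bar a\cdot z}$ if $n=2s$, and put $e_a=k_a/\|k_a\|_{s,p}$. For a finite sequence $S=\{a_k\}_{k\in\mathbb Z/N}$ and $\theta=e^{2\pi i/N}$, a canonical dual sequence of $S$ (with constant $C$) is any sequence $\gamma_{a_k}=\frac1N\sum_{j\in\mathbb Z/N}\theta^{-jk}\beta_j$, where $\beta_j\in\mathcal M_s^p$ satisfies $\beta_j(a_k)=\theta^{jk}$ for all $k$ and $\|\beta_j\|_{\mathcal M_s^p}\le C$. Theorem. Let $C>0$. (1) For every integer $l>s$ with $(l-s)p\ge 2(p-1)$ (that is, $(l-s)p'\ge2$ with $\frac1p+\frac1{p'}=1$) there is a constant $K$, depending only on $n,s,p,l,C$, such that for every finite sequence $S\subset\mathbb B$ that is interpolating for $\mathcal M_s^p$ with constant $C$: $S$ has a canonical dual sequence with constant $C$, and for every such sequence $\{\gamma_a\}_{a\in S}$ and every $\lambda\in\mathbb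 C^S$ the function $$f=\sum_{a\in S}\lambda_a\gamma_a^l e_a$$ belongs to $H_s^p$, satisfies $\|f\|_{s,p}\le K\|\lambda\|_p$, and $f(b)=\lambda_b e_b(b)$ for all $b\in S$. (2) There is a constant $K$, depending only on $n,s,p,C$, such that every (finite or infinite) family $S$ of points of $\mathbb B$ that is interpolating for $\mathcal M_s^p$ with constant $C$ is interpolating for $H_s^p$ with constant $K$, and has a bounded linear extension operator $\ell^p(S)\to H_s^p$ of norm at most $K$. -/

import Mathlib

open MeasureTheory
open scoped ENNReal

noncomputable section

namespace HardySobolev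

/-- The space `ℂⁿ` with its Hermitian norm. -/
abbrev Cn (n : ℕ) : Type := EuclideanSpace ℂ (Fin n)

/-- The open unit ball of `ℂⁿ`. -/
abbrev unitBall (n : ℕ) : Set (Cn n) := Metric.ball (0 : Cn n) 1

/-- Lebesgue (surface) measure on the unit sphere of `ℂⁿ`. -/
def sigma (n : ℕ) : Measure (Metric.sphere (0 : Cn n) 1) :=
  (volume : Measure (Cn n)).toSphere

/-- The radial derivative `R f (z) = ∑ j, z j * (∂f/∂z_j)(z)`. -/
def radialDeriv {n : ℕ} (f : Cn n → ℂ) : Cn n → ℂ :=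
  fun z => ∑ j : Fin n, z j * fderiv ℂ f z (EuclideanSpace.single j 1)

/-- The operator `I + R`. -/
def idAddRadial {n : ℕ} (f : Cn n → ℂ) : Cn n → ℂ :=
  fun z => f z + radialDeriv f z

/-- The norm `‖f‖_{s,p} = (sup_{r < 1} ∫ |(I + R)^s f (r ζ)|^p dσ(ζ))^{1/p}`, with values in
`[0, ∞]`. -/
def hsNorm {n : ℕ} (s : ℕ) (p : ℝ) (f : Cn n → ℂ) : ℝ≥0∞ :=
  (⨆ r ∈ Set.Ico (0 : ℝ) 1,
    ∫⁻ ζ : Metric.sphere (0 : Cn n) 1,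
      ‖(idAddRadial^[s] f) (r • (ζ : Cn n))‖ₑ ^ p ∂(sigma n)) ^ (1 / p)

/-- `f` belongs to the Hardy-Sobolev space `H_s^p` of the unit ball: it is holomorphic in the ball
and its norm is finite. Only the values of `f` in the ball matter. -/
def MemHS {n : ℕ} (s : ℕ) (p : ℝ) (f : Cn n → ℂ) : Prop :=
  DifferentiableOn ℂ f (unitBall n) ∧ hsNorm s p f < ∞

/-- `m` is a multiplier of `H_s^p`. -/
def IsMultiplier {n : ℕ} (s : ℕ) (p : ℝ) (m : Cn n → ℂ) : Prop :=
  ∀ h : Cn n → ℂ, MemHS s p h → MemHS s p (fun z => m z * h z)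

/-- The norm of a multiplier: its norm as an operator on `H_s^p`. -/
def multNorm {n : ℕ} (s : ℕ) (p : ℝ) (m : Cn n → ℂ) : ℝ≥0∞ :=
  sInf {c : ℝ≥0∞ | ∀ h : Cn n → ℂ, MemHS s p h →
    hsNorm s p (fun z => m z * h z) ≤ c * hsNorm s p h}

/-- The family of points `a` is interpolating for the multiplier algebra of `H_s^p`, and `C` is an
interpolating constant for it. -/
def InterpolatesMult {n : ℕ} (s : ℕ) (p : ℝ) {ι : Type} (a : ι → Cn n) (C : ℝ) : Prop :=
  ∀ μ : lp (fun _ : ι => ℂ) ∞, ∃ m : Cn n → ℂ,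
    IsMultiplier s p m ∧ (∀ i, m (a i) = μ i) ∧ multNorm s p m ≤ ENNReal.ofReal (C * ‖μ‖)

/-- The weight `(1 - |a|²)^{s - n/p}`. -/
def weight {n : ℕ} (s : ℕ) (p : ℝ) (a : Cn n) : ℝ :=
  (1 - ‖a‖ ^ 2) ^ ((s : ℝ) - n / p)

/-- The family of points `a` is interpolating for `H_s^p`, with constant `K`. -/
def InterpolatesHS {n : ℕ} (s : ℕ) (p : ℝ) {ι : Type} (a : ι → Cn n) (K : ℝ) : Prop :=
  ∀ μ : lp (fun _ : ι => ℂ) (ENNReal.ofReal p), ∃ f : Cn n → ℂ,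
    MemHS s p f ∧ (∀ i, f (a i) = μ i * (weight s p (a i) : ℂ)) ∧
      hsNorm s p f ≤ ENNReal.ofReal (K * ‖μ‖)

/-- The family of points `a` has a bounded linear extension operator `ℓ^p → H_s^p`, of norm at
most `K`. -/
def HasExtensionOperator {n : ℕ} (s : ℕ) (p : ℝ) {ι : Type} (a : ι → Cn n) (K : ℝ) : Prop :=
  ∃ T : lp (fun _ : ι => ℂ) (ENNReal.ofReal p) →ₗ[ℂ] (Cn n → ℂ),
    ∀ μ, MemHS s p (T μ) ∧ (∀ i, T μ (a i) = μ i * (weight s p (a i) : ℂ)) ∧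
      hsNorm s p (T μ) ≤ ENNReal.ofReal (K * ‖μ‖)

/-- The reproducing kernel `k_a(z) = (1 - ā·z)^{-(n - 2s)}`, which is logarithmic for `n = 2s`;
here `ā·z = inner ℂ a z`. -/
def kernel {n : ℕ} (s : ℕ) (a : Cn n) : Cn n → ℂ := fun z =>
  if n = 2 * s then 1 - Complex.log (1 - inner ℂ a z)
  else (1 - inner ℂ a z) ^ (-((n : ℤ) - 2 * (s : ℤ)))

/-- The kernel normalised in `H_s^p`: `e_a = k_a / ‖k_a‖_{s,p}`. -/
def normKernel {n : ℕ} (s : ℕ) (p : ℝ) (a : Cn n) : Cn n → ℂ := fun z =>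
  kernel s a z / ((hsNorm s p (kernel s a)).toReal : ℂ)

/-- `γ` is a canonical dual sequence of the finite sequence `a` in the multiplier algebra of
`H_s^p`: with `θ = exp(2πi/N)`, it is the discrete Fourier transform
`γ k = N⁻¹ ∑ j, θ^{-jk} β j` of multipliers `β j` of norm at most `C` such that
`β j (a k) = θ^{jk}`. The indices are residues modulo `N`. -/
def IsCanonicalDual {n : ℕ} (s : ℕ) (p : ℝ) {N : ℕ} (a : Fin N → Cn n) (C : ℝ)
    (γ : Fin N → Cn n → ℂ) : Prop :=
  ∃ β : Fin N → Cn n → ℂ,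
    (∀ j, IsMultiplier s p (β j) ∧ multNorm s p (β j) ≤ ENNReal.ofReal C ∧
      ∀ k, β j (a k) = Complex.exp (2 * Real.pi * Complex.I / N) ^ ((j : ℕ) * (k : ℕ))) ∧
    ∀ k z, γ k z = (1 / (N : ℂ)) * ∑ j : Fin N,
      (Complex.exp (2 * Real.pi * Complex.I / N))⁻¹ ^ ((j : ℕ) * (k : ℕ)) * β j z

end HardySobolev

end

open Filter Topology

noncomputable section

namespace HardySobolev

variable {n : ℕ}

/-! The estimate holds for sums `∑ μ_k γ_k^l e_k` with any holomorphic `e_k` of bounded norm, and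
rests on two facts.

First, for fixed `g` and `f`, Leibniz gives `(I + R)^s (g^q f) = ∑_{i ≤ s} q(q-1)⋯(q-i+1) g^{q-i}
A_i` with `A_i` independent of `q`. Up to the factor `g^q` this is a polynomial in `q` of degree at
most `s`, hence determined by its values at `q = 0, …, s`. Lagrange interpolation gives `(I + R)^s
(g^l f) = ∑_{q ≤ s} c_q g^{l-q} (I + R)^s (g^q f)` with constants `c_q` depending only on `s` and
`l` (`exists_iterate_idAddRadial_pow_mul_eq_sum`). Derivatives of `g` now occur only inside `(I +
R)^s (g^q f)`, whose size is controlled because `g` is a multiplier.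

Second, a multiplier is bounded in the ball by its multiplier norm, so Parseval for the discrete
Fourier transform gives `∑ |γ_k(z)|^2 ≤ C^2` (`IsCanonicalDual.sum_norm_sq_le`). Since `(l-s)p' ≥
2`, Hölder's inequality bounds `∑ |μ_k| |γ_k|^{l-q} |w_k|` pointwise by a constant times `(∑ |μ_k|^p
|w_k|^p)^{1/p}`, where `w_k = (I + R)^s (γ_k^q e_k)`. The `L^p` norm of the latter is immediate
(`exists_hsNorm_sum_pow_mul_le`).

For the second claim, `e_k` is replaced by explicit functions `peak`, which take exactly the value
`weight` at their centres and have uniformly bounded norm, by an integral estimate on the sphere.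
This gives operators on finite subfamilies with a common bound; their limit along an ultrafilter of
finite sets is linear, and bounded by normality and Fatou's lemma. -/

theorem radialDeriv_eq_fderiv (f : Cn n → ℂ) (z : Cn n) : radialDeriv f z = fderiv ℂ f z z := by
  have h : z = ∑ j, z j • EuclideanSpace.single j (1 : ℂ) := by
    ext i
    simp [Finset.sum_apply, Pi.single_apply]
  have h2 := congrArg (fderiv ℂ f z) h
  rw [h2, map_sum]
  simp [radialDeriv]

theorem idAddRadial_eq (f : Cn n → ℂ) (z : Cn n) : idAddRadial f z = f z + fderiv ℂ f z z := by
  rw [idAddRadial, radialDeriv_eq_fderiv]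

/-! ### Schwarz estimates and ultrafilter limits of holomorphic functions -/

section Schwarz

variable {E : Type*} [NormedAddCommGroup E] [NormedSpace ℂ E]

theorem norm_fderiv_le_of_bounded {f : E → ℂ} {z : E} {ρ M : ℝ} (hρ : 0 < ρ)
    (hf : DifferentiableOn ℂ f (Metric.ball z ρ)) (hM : ∀ w ∈ Metric.ball z ρ, ‖f w‖ ≤ M) :
    ‖fderiv ℂ f z‖ ≤ 2 * M / ρ := by
  refine Complex.norm_fderiv_le_div_of_mapsTo_ball hf (fun w hw => ?_) hρ
  rw [mem_closedBall_iff_norm]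
  linarith [norm_sub_le (f w) (f z), hM w hw, hM z (Metric.mem_ball_self hρ)]

theorem norm_sub_le_of_bounded {f : E → ℂ} {z w : E} {ρ M : ℝ}
    (hf : DifferentiableOn ℂ f (Metric.ball z ρ)) (hM : ∀ w ∈ Metric.ball z ρ, ‖f w‖ ≤ M)
    (hw : w ∈ Metric.ball z ρ) : ‖f w - f z‖ ≤ 2 * M / ρ * ‖w - z‖ := by
  have hρ : 0 < ρ := dist_nonneg.trans_lt hw
  have := Complex.dist_le_div_mul_dist_of_mapsTo_ball (R₂ := 2 * M) hf (fun w hw => ?_) hw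
  · rwa [dist_eq_norm, dist_eq_norm] at this
  rw [mem_closedBall_iff_norm]
  linarith [norm_sub_le (f w) (f z), hM w hw, hM z (Metric.mem_ball_self hρ)]

/-- Schwarz's lemma of order two, applied to `f` minus its linear part. That function stays within
`4M` of its central value: `2M` from `f` and `2M` from the linear part. -/
theorem norm_taylor_le_of_bounded {f : E → ℂ} {z w : E} {ρ M : ℝ}
    (hf : DifferentiableOn ℂ f (Metric.ball z ρ)) (hM : ∀ w ∈ Metric.ball z ρ, ‖f w‖ ≤ M)
    (hw : w ∈ Metric.ball z ρ) :
    ‖f w - f z - fderiv ℂ f z (w - z)‖ ≤ 4 * M * (‖w - z‖ / ρ) ^ 2 := by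
  have hρ : 0 < ρ := dist_nonneg.trans_lt hw
  have hd := norm_fderiv_le_of_bounded hρ hf hM
  have hfz := hf.differentiableAt (Metric.isOpen_ball.mem_nhds (Metric.mem_ball_self hρ))
  have := Complex.dist_le_mul_div_pow_of_mapsTo_ball_of_isLittleO (n := 1) (R₂ := 4 * M)
    (f := fun w => f w - fderiv ℂ f z (w - z)) (c := z) (z := w) (R₁ := ρ) ?_ ?_ ?_ hw
  · rw [dist_eq_norm, dist_eq_norm] at this
    rwa [sub_self, map_zero, sub_zero, sub_right_comm] at this
  · exact hf.sub ((fderiv ℂ f z).differentiable.comp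
      (differentiable_id.sub_const z)).differentiableOn
  · intro w hw
    rw [mem_closedBall_iff_norm]
    have h1 : ‖fderiv ℂ f z (w - z)‖ ≤ 2 * M := by
      refine ((fderiv ℂ f z).le_opNorm _).trans ?_
      calc _ ≤ 2 * M / ρ * ρ := by
            gcongr
            · exact (norm_nonneg _).trans hd
            · exact (mem_ball_iff_norm.1 hw).le
        _ = _ := by field_simp
    have h2 := hM w hw
    have h3 := hM z (Metric.mem_ball_self hρ)
    have h4 := norm_sub_le (f w - fderiv ℂ f z (w - z)) (f z)
    have h5 := norm_sub_le (f w) (fderiv ℂ f z (w - z))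
    simp only [sub_self, map_zero, sub_zero]
    linarith
  · have := hfz.hasFDerivAt.isLittleO
    simp only [sub_self, map_zero, sub_zero, pow_one]
    exact (this.congr_left fun w => by ring).norm_right

end Schwarz

theorem exists_forall_norm_le {f : Cn n → ℂ} (hf : DifferentiableOn ℂ f (unitBall n)) {r : ℝ}
    (hr : r < 1) : ∃ M, ∀ z ∈ Metric.closedBall (0 : Cn n) r, ‖f z‖ ≤ M := by
  have := (isCompact_closedBall (0 : Cn n) r).exists_bound_of_continuousOn
    (hf.continuousOn.mono (Metric.closedBall_subset_ball hr))
  exact this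

/-- The derivatives at `z` stay in a compact ball, so they converge along the ultrafilter. The
quadratic Taylor bound is uniform and passes to the limit, which makes the limit of the derivatives
the derivative of the limit. -/
theorem hasFDerivAt_of_tendsto_of_bounded {X : Type*} (U : Ultrafilter X) {F : X → Cn n → ℂ}
    {f : Cn n → ℂ} {z : Cn n} {ρ M : ℝ} (hρ : 0 < ρ)
    (hF : ∀ᶠ x in U, DifferentiableOn ℂ (F x) (Metric.ball z ρ))
    (hM : ∀ᶠ x in U, ∀ w ∈ Metric.ball z ρ, ‖F x w‖ ≤ M)
    (hf : ∀ w ∈ Metric.ball z ρ, Tendsto (fun x => F x w) U (𝓝 (f w))) :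
    ∃ L, HasFDerivAt f L z ∧ Tendsto (fun x => fderiv ℂ (F x) z) U (𝓝 L) := by
  have hb : ∀ᶠ x in U, fderiv ℂ (F x) z ∈ Metric.closedBall 0 (2 * M / ρ) := by
    filter_upwards [hF, hM] with x h1 h2
    rw [mem_closedBall_zero_iff]
    exact norm_fderiv_le_of_bounded hρ h1 h2
  obtain ⟨L, -, hL⟩ := (isCompact_closedBall (0 : Cn n →L[ℂ] ℂ) (2 * M / ρ)).ultrafilter_le_nhds
    (U.map fun x => fderiv ℂ (F x) z) (le_principal_iff.2 hb)
  have hL : Tendsto (fun x => fderiv ℂ (F x) z) U (𝓝 L) := hL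
  refine ⟨L, ?_, hL⟩
  have key : ∀ w ∈ Metric.ball z ρ, ‖f w - f z - L (w - z)‖ ≤ 4 * M * (‖w - z‖ / ρ) ^ 2 := by
    intro w hw
    have h1 : Tendsto (fun x => ‖F x w - F x z - fderiv ℂ (F x) z (w - z)‖) U
        (𝓝 ‖f w - f z - L (w - z)‖) :=
      (((hf w hw).sub (hf z (Metric.mem_ball_self hρ))).sub
        ((ContinuousLinearMap.apply ℂ ℂ (w - z)).continuous.tendsto L |>.comp hL)).norm
    refine le_of_tendsto h1 ?_
    filter_upwards [hF, hM] with x h1 h2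
    exact norm_taylor_le_of_bounded h1 h2 hw
  rw [hasFDerivAt_iff_isLittleO]
  have h2 : (fun w => f w - f z - L (w - z)) =O[𝓝 z] fun w => ‖w - z‖ ^ 2 := by
    refine Asymptotics.IsBigO.of_bound (4 * M / ρ ^ 2) ?_
    filter_upwards [Metric.ball_mem_nhds z hρ] with w hw
    refine (key w hw).trans (le_of_eq ?_)
    rw [norm_pow, norm_norm]; ring
  refine h2.trans_isLittleO ?_
  have h3 : (fun w : Cn n => ‖w - z‖ ^ 2) =o[𝓝 z] fun w => ‖w - z‖ := by
    have : Tendsto (fun w : Cn n => ‖w - z‖) (𝓝 z) (𝓝 0) := by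
      have : Continuous fun w : Cn n => ‖w - z‖ := by fun_prop
      simpa using this.tendsto z
    have h := (Asymptotics.isLittleO_pow_id (𝕜 := ℝ) (n := 2) (by norm_num)).comp_tendsto this
    exact h
  exact h3.of_norm_right

theorem differentiableOn_radialDeriv {f : Cn n → ℂ} (hf : DifferentiableOn ℂ f (unitBall n)) :
    DifferentiableOn ℂ (radialDeriv f) (unitBall n) := by
  intro z hz
  refine DifferentiableAt.differentiableWithinAt ?_
  rw [mem_ball_zero_iff] at hz
  obtain ⟨r, hzr, hr⟩ := exists_between hz
  obtain ⟨M, hM⟩ := exists_forall_norm_le hf hr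
  set ρ := (r - ‖z‖) / 2 with hρdef
  have hρ : 0 < ρ := by rw [hρdef]; linarith
  -- Difference quotients in the radial direction: holomorphic near `z`, bounded by the first-order
  -- Schwarz estimate, and convergent to `radialDeriv f`.
  let q : ℕ → Cn n → ℂ := fun m w => (m + 1 : ℂ) * (f (w + (1 / (m + 1 : ℂ)) • w) - f w)
  have hball : ∀ w ∈ Metric.ball z ρ, ‖w‖ + ρ < r := by
    intro w hw
    rw [mem_ball_iff_norm] at hw
    have := norm_le_norm_add_norm_sub' w z
    have h2 : ρ = (r - ‖z‖) / 2 := hρdef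
    linarith
  have hsub : ∀ w ∈ Metric.ball z ρ, Metric.ball w ρ ⊆ Metric.closedBall 0 r := by
    intro w hw v hv
    rw [mem_closedBall_zero_iff]
    rw [mem_ball_iff_norm] at hv
    have := norm_le_norm_add_norm_sub' v w
    linarith [hball w hw]
  have hsub' : Metric.closedBall (0 : Cn n) r ⊆ unitBall n := Metric.closedBall_subset_ball hr
  have hsmall : ∀ᶠ m : ℕ in atTop, 1 / (m + 1 : ℝ) < ρ :=
    tendsto_one_div_add_atTop_nhds_zero_nat.eventually (gt_mem_nhds hρ)
  have hU : ∀ {P : ℕ → Prop}, (∀ᶠ m in atTop, P m) → ∀ᶠ m in (hyperfilter ℕ : Filter ℕ), P m :=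
    fun h => Nat.hyperfilter_le_atTop h
  have hnorm : ∀ m : ℕ, ‖(m + 1 : ℂ)‖ = m + 1 := fun m => by
    have : (m + 1 : ℂ) = ((m + 1 : ℕ) : ℂ) := by push_cast; rfl
    rw [this, Complex.norm_natCast]; push_cast; rfl
  have hmem : ∀ m : ℕ, 1 / (m + 1 : ℝ) < ρ → ∀ w ∈ Metric.ball z ρ,
      w + (1 / (m + 1 : ℂ)) • w ∈ Metric.ball w ρ := by
    intro m hm w hw
    rw [mem_ball_iff_norm, add_sub_cancel_left, norm_smul, norm_div, norm_one, hnorm]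
    have h1 := hball w hw
    have : ‖w‖ ≤ 1 := by linarith
    calc _ ≤ 1 / (m + 1 : ℝ) * 1 := by gcongr
      _ < ρ := by simpa using hm
  suffices h : ∃ L, HasFDerivAt (radialDeriv f) L z ∧
      Tendsto (fun x => fderiv ℂ (q x) z) (hyperfilter ℕ) (𝓝 L) by
    obtain ⟨L, hL, -⟩ := h
    exact hL.differentiableAt
  refine hasFDerivAt_of_tendsto_of_bounded (hyperfilter ℕ) (M := 2 * M / ρ) hρ
    (hU ?_) (hU ?_) ?_
  · filter_upwards [hsmall] with m hm
    refine DifferentiableOn.const_mul (DifferentiableOn.sub ?_ ?_) _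
    · refine hf.comp (f := fun w => w + (1 / (m + 1 : ℂ)) • w) ?_ ?_
      · fun_prop
      · intro w hw
        exact hsub' (hsub w hw (hmem m hm w hw))
    · exact hf.mono fun w hw => hsub' (hsub w hw (Metric.mem_ball_self hρ))
  · filter_upwards [hsmall] with m hm
    intro w hw
    have h1 := norm_sub_le_of_bounded (hf.mono ((hsub w hw).trans hsub'))
      (fun v hv => hM v (hsub w hw hv)) (hmem m hm w hw)
    have hM0 : 0 ≤ 2 * M / ρ := (norm_nonneg _).trans (norm_fderiv_le_of_bounded hρ
      (hf.mono ((hsub w hw).trans hsub')) (fun v hv => hM v (hsub w hw hv)))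
    rw [add_sub_cancel_left, norm_smul, norm_div, norm_one, hnorm] at h1
    simp only [q]
    rw [norm_mul, hnorm]
    have hw1 : ‖w‖ ≤ 1 := by linarith [hball w hw]
    calc _ ≤ (m + 1 : ℝ) * (2 * M / ρ * (1 / (m + 1 : ℝ) * 1)) := by
          gcongr
          exact h1.trans (by gcongr)
      _ = _ := by field_simp
  · intro w hw
    refine Tendsto.mono_left ?_ Nat.hyperfilter_le_atTop
    have hd : DifferentiableAt ℂ f w := hf.differentiableAt
      (Metric.isOpen_ball.mem_nhds (hsub' (hsub w hw (Metric.mem_ball_self hρ))))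
    rw [radialDeriv_eq_fderiv]
    have h1 : HasDerivAt (fun t : ℂ => f (w + t • w)) (fderiv ℂ f w w) 0 := by
      have h2 : HasDerivAt (fun t : ℂ => w + t • w) w 0 := by
        simpa using ((hasDerivAt_id (0 : ℂ)).smul_const w).const_add w
      have h3 : HasFDerivAt f (fderiv ℂ f w) (w + (0 : ℂ) • w) := by simpa using hd.hasFDerivAt
      exact h3.comp_hasDerivAt 0 h2
    have h4 := (hasDerivAt_iff_tendsto_slope_zero.1 h1)
    have h5 : Tendsto (fun m : ℕ => 1 / (m + 1 : ℂ)) atTop (𝓝[≠] 0) := by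
      refine tendsto_nhdsWithin_iff.2 ⟨tendsto_one_div_add_atTop_nhds_zero_nat, ?_⟩
      refine Eventually.of_forall fun m => ?_
      have := hnorm m
      have h0 : (m + 1 : ℂ) ≠ 0 := by
        rw [← norm_ne_zero_iff, this]; positivity
      simpa using h0
    refine (h4.comp h5).congr fun m => ?_
    simp [q]

/-! ### Iterates of `I + R` on sums and on products with powers -/

theorem differentiableOn_idAddRadial {f : Cn n → ℂ} (hf : DifferentiableOn ℂ f (unitBall n)) :
    DifferentiableOn ℂ (idAddRadial f) (unitBall n) :=
  hf.add (differentiableOn_radialDeriv hf)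

theorem differentiableOn_iterate_idAddRadial {f : Cn n → ℂ}
    (hf : DifferentiableOn ℂ f (unitBall n)) (s : ℕ) :
    DifferentiableOn ℂ (idAddRadial^[s] f) (unitBall n) := by
  induction s generalizing f with
  | zero => exact hf
  | succ s ih => exact ih (differentiableOn_idAddRadial hf)

theorem eqOn_idAddRadial {f g : Cn n → ℂ} (h : Set.EqOn f g (unitBall n)) :
    Set.EqOn (idAddRadial f) (idAddRadial g) (unitBall n) := by
  intro z hz
  have : f =ᶠ[𝓝 z] g := h.eventuallyEq_of_mem (Metric.isOpen_ball.mem_nhds hz)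
  rw [idAddRadial_eq, idAddRadial_eq, this.fderiv_eq, h hz]

theorem eqOn_iterate_idAddRadial {f g : Cn n → ℂ} (h : Set.EqOn f g (unitBall n)) (s : ℕ) :
    Set.EqOn (idAddRadial^[s] f) (idAddRadial^[s] g) (unitBall n) := by
  induction s generalizing f g with
  | zero => exact h
  | succ s ih => exact ih (eqOn_idAddRadial h)

theorem differentiableAt_of_mem_unitBall {f : Cn n → ℂ}
    (hf : DifferentiableOn ℂ f (unitBall n)) {z : Cn n} (hz : z ∈ unitBall n) :
    DifferentiableAt ℂ f z :=
  hf.differentiableAt (Metric.isOpen_ball.mem_nhds hz)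

theorem idAddRadial_sum {ι : Type*} (t : Finset ι) (c : ι → ℂ) {F : ι → Cn n → ℂ}
    (hF : ∀ i ∈ t, DifferentiableOn ℂ (F i) (unitBall n)) :
    Set.EqOn (idAddRadial fun z => ∑ i ∈ t, c i * F i z)
      (fun z => ∑ i ∈ t, c i * idAddRadial (F i) z) (unitBall n) := by
  intro z hz
  have hd : ∀ i ∈ t, HasFDerivAt (fun z => c i * F i z) (c i • fderiv ℂ (F i) z) z := fun i hi =>
    (differentiableAt_of_mem_unitBall (hF i hi) hz).hasFDerivAt.const_mul (c i)
  have h := (HasFDerivAt.fun_sum hd).fderiv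
  simp only [idAddRadial_eq, h, mul_add, Finset.sum_add_distrib]
  simp

theorem iterate_idAddRadial_sum {ι : Type*} (t : Finset ι) (c : ι → ℂ) {F : ι → Cn n → ℂ}
    (hF : ∀ i ∈ t, DifferentiableOn ℂ (F i) (unitBall n)) (s : ℕ) :
    Set.EqOn (idAddRadial^[s] fun z => ∑ i ∈ t, c i * F i z)
      (fun z => ∑ i ∈ t, c i * (idAddRadial^[s] (F i)) z) (unitBall n) := by
  induction s generalizing F with
  | zero => exact fun z _ => rfl
  | succ s ih =>
    exact (eqOn_iterate_idAddRadial (idAddRadial_sum t c hF) s).trans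
      (ih fun i hi => differentiableOn_idAddRadial (hF i hi))

theorem iterate_idAddRadial_one (s : ℕ) :
    idAddRadial^[s] (fun _ : Cn n => (1 : ℂ)) = fun _ => 1 := by
  have h : idAddRadial (fun _ : Cn n => (1 : ℂ)) = fun _ => 1 := by
    ext z
    simp [idAddRadial_eq]
  exact Function.iterate_fixed h s

theorem idAddRadial_pow_mul {g f : Cn n → ℂ} {z : Cn n} (hg : DifferentiableAt ℂ g z)
    (hf : DifferentiableAt ℂ f z) (m : ℕ) :
    idAddRadial (fun z => g z ^ m * f z) z =
      g z ^ m * idAddRadial f z + m * g z ^ (m - 1) * (radialDeriv g z * f z) := by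
  have h := ((hg.hasFDerivAt.pow m).mul hf.hasFDerivAt).fderiv
  rw [idAddRadial_eq, idAddRadial_eq, radialDeriv_eq_fderiv]
  erw [h]
  simp
  ring

/-- The point is that `A` does not depend on `q`: the exponent enters only through `q.descFactorial
i` and `g z ^ (q - i)`. -/
theorem exists_iterate_idAddRadial_pow_mul {g f : Cn n → ℂ}
    (hg : DifferentiableOn ℂ g (unitBall n)) (hf : DifferentiableOn ℂ f (unitBall n)) (s : ℕ) :
    ∃ A : ℕ → Cn n → ℂ, (∀ i, DifferentiableOn ℂ (A i) (unitBall n)) ∧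
      ∀ q : ℕ, Set.EqOn (idAddRadial^[s] fun z => g z ^ q * f z)
        (fun z => ∑ i ∈ Finset.range (s + 1), (q.descFactorial i : ℂ) * (g z ^ (q - i) * A i z))
        (unitBall n) := by
  induction s with
  | zero => exact ⟨fun _ => f, fun _ => hf, fun q z _ => by simp⟩
  | succ s ih =>
    obtain ⟨A, hA, h⟩ := ih
    refine ⟨fun i z => (if i ≤ s then idAddRadial (A i) z else 0) +
      (if i = 0 then 0 else radialDeriv g z * A (i - 1) z), fun i => ?_, fun q z hz => ?_⟩
    · refine DifferentiableOn.add ?_ ?_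
      · split_ifs
        · exact differentiableOn_idAddRadial (hA i)
        · exact differentiableOn_const _
      · split_ifs
        · exact differentiableOn_const _
        · exact (differentiableOn_radialDeriv hg).mul (hA _)
    · rw [Function.iterate_succ_apply', eqOn_idAddRadial (h q) hz,
        idAddRadial_sum (Finset.range (s + 1)) (fun i => (q.descFactorial i : ℂ))
          (F := fun i z => g z ^ (q - i) * A i z) (fun i _ => (hg.pow _).mul (hA i)) hz]
      have h1 : ∀ B : ℕ → ℂ, ∑ i ∈ Finset.range (s + 1 + 1), (q.descFactorial i : ℂ) *
          (g z ^ (q - i) * if i ≤ s then B i else 0) =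
          ∑ i ∈ Finset.range (s + 1), (q.descFactorial i : ℂ) *
            (g z ^ (q - i) * if i ≤ s then B i else 0) := fun B => by
        rw [Finset.sum_range_succ, if_neg (by lia), mul_zero, mul_zero, add_zero]
      have h2 : ∀ B : ℕ → ℂ, ∑ i ∈ Finset.range (s + 1 + 1), (q.descFactorial i : ℂ) *
          (g z ^ (q - i) * if i = 0 then 0 else B i) =
          ∑ i ∈ Finset.range (s + 1), (q.descFactorial (i + 1) : ℂ) *
            (g z ^ (q - (i + 1)) * B (i + 1)) := fun B => by
        rw [Finset.sum_range_succ']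
        simp
      simp only [mul_add, Finset.sum_add_distrib]
      rw [h1 fun i => idAddRadial (A i) z, h2 fun i => radialDeriv g z * A (i - 1) z,
        ← Finset.sum_add_distrib]
      refine Finset.sum_congr rfl fun i hi => ?_
      rw [Finset.mem_range] at hi
      rw [if_pos (by lia), idAddRadial_pow_mul
        (differentiableAt_of_mem_unitBall hg hz)
        (differentiableAt_of_mem_unitBall (hA i) hz), Nat.descFactorial_succ,
        Nat.sub_sub]
      rw [Nat.add_sub_cancel]
      -- For `q < i` the falling factorial vanishes, so the truncated subtraction `q - i` is
      -- harmless.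
      rcases lt_or_ge q i with hqi | hqi
      · simp [Nat.descFactorial_of_lt hqi]
      · push_cast [Nat.cast_sub hqi]
        ring

/-- Falling factorials of order at most `s` are polynomials of degree at most `s`, so Lagrange
interpolation at the nodes `0, …, s`, evaluated at `l`, reproduces them exactly. -/
theorem exists_sum_mul_descFactorial (s l : ℕ) : ∃ c : ℕ → ℂ, ∀ i ≤ s,
    ∑ q ∈ Finset.range (s + 1), c q * (q.descFactorial i : ℂ) = l.descFactorial i := by
  refine ⟨fun q => (Lagrange.basis (Finset.range (s + 1)) (Nat.cast : ℕ → ℂ) q).eval (l : ℂ),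
    fun i hi => ?_⟩
  have hinj : Set.InjOn (Nat.cast : ℕ → ℂ) (Finset.range (s + 1)) := Nat.cast_injective.injOn
  have h := Lagrange.eq_interpolate (f := descPochhammer ℂ i) hinj (by
    rw [Finset.card_range]
    refine (Polynomial.degree_le_natDegree).trans_lt ?_
    rw [descPochhammer_natDegree]
    exact_mod_cast Nat.lt_succ_of_le hi)
  have h2 := congrArg (Polynomial.eval (l : ℂ)) h
  rw [descPochhammer_eval_eq_descFactorial, Lagrange.interpolate_apply,
    Polynomial.eval_finsetSum] at h2
  rw [h2]
  refine Finset.sum_congr rfl fun q _ => ?_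
  rw [descPochhammer_eval_eq_descFactorial, Polynomial.eval_mul, Polynomial.eval_C, mul_comm]

theorem exists_iterate_idAddRadial_pow_mul_eq_sum (n s l : ℕ) (hl : s ≤ l) :
    ∃ c : ℕ → ℂ, ∀ g f : Cn n → ℂ,
      DifferentiableOn ℂ g (unitBall n) → DifferentiableOn ℂ f (unitBall n) →
      Set.EqOn (idAddRadial^[s] fun z => g z ^ l * f z)
        (fun z => ∑ q ∈ Finset.range (s + 1),
          c q * (g z ^ (l - q) * (idAddRadial^[s] fun z => g z ^ q * f z) z))
        (unitBall n) := by
  obtain ⟨c, hc⟩ := exists_sum_mul_descFactorial s l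
  refine ⟨c, fun g f hg hf z hz => ?_⟩
  obtain ⟨A, -, h⟩ := exists_iterate_idAddRadial_pow_mul hg hf s
  rw [h l hz]
  simp only
  have : ∀ q ∈ Finset.range (s + 1),
      c q * (g z ^ (l - q) * (idAddRadial^[s] fun z => g z ^ q * f z) z) =
      ∑ i ∈ Finset.range (s + 1), (c q * (q.descFactorial i : ℂ)) * (g z ^ (l - i) * A i z) := by
    intro q hq
    rw [h q hz, Finset.mul_sum, Finset.mul_sum]
    refine Finset.sum_congr rfl fun i hi => ?_
    rw [Finset.mem_range] at hq hi
    rcases lt_or_ge q i with hqi | hqi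
    · simp [Nat.descFactorial_of_lt hqi]
    · have : l - i = (l - q) + (q - i) := by lia
      rw [this, pow_add]
      ring
  rw [Finset.sum_congr rfl this, Finset.sum_comm]
  refine Finset.sum_congr rfl fun i hi => ?_
  rw [← Finset.sum_mul, hc i (by rw [Finset.mem_range] at hi; lia)]

/-! ### The norm of `H_s^p` and multipliers -/

instance : IsFiniteMeasure (sigma n) := by unfold sigma; infer_instance

theorem smul_sphere_mem_unitBall {r : ℝ} (hr : r ∈ Set.Ico (0 : ℝ) 1)
    (ζ : Metric.sphere (0 : Cn n) 1) : r • (ζ : Cn n) ∈ unitBall n := by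
  rw [mem_ball_zero_iff, norm_smul, norm_eq_of_mem_sphere, mul_one, Real.norm_of_nonneg hr.1]
  exact hr.2

/-- The restriction of `(I + R)^s f` to the sphere of radius `r`. -/
def slice (s : ℕ) (f : Cn n → ℂ) (r : ℝ) (ζ : Metric.sphere (0 : Cn n) 1) : ℂ :=
  (idAddRadial^[s] f) (r • (ζ : Cn n))

theorem continuous_slice {f : Cn n → ℂ} (hf : DifferentiableOn ℂ f (unitBall n)) (s : ℕ) {r : ℝ}
    (hr : r ∈ Set.Ico (0 : ℝ) 1) : Continuous (slice s f r) :=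
  (differentiableOn_iterate_idAddRadial hf s).continuousOn.comp_continuous (by fun_prop)
    (smul_sphere_mem_unitBall hr)

theorem hsNorm_le_iff {s : ℕ} {p : ℝ} (hp : 1 ≤ p) {f : Cn n → ℂ} {c : ℝ≥0∞} :
    hsNorm s p f ≤ c ↔
      ∀ r ∈ Set.Ico (0 : ℝ) 1, eLpNorm (slice s f r) (ENNReal.ofReal p) (sigma n) ≤ c := by
  have hp0 : 0 < p := by linarith
  rw [hsNorm, one_div, ENNReal.rpow_inv_le_iff hp0, iSup₂_le_iff]
  refine forall₂_congr fun r _ => ?_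
  rw [eLpNorm_eq_lintegral_rpow_enorm_toReal (by simpa using hp0) ENNReal.ofReal_ne_top,
    ENNReal.toReal_ofReal hp0.le, one_div, ENNReal.rpow_inv_le_iff hp0]
  rfl

theorem eLpNorm_slice_le {s : ℕ} {p : ℝ} (hp : 1 ≤ p) (f : Cn n → ℂ) {r : ℝ}
    (hr : r ∈ Set.Ico (0 : ℝ) 1) :
    eLpNorm (slice s f r) (ENNReal.ofReal p) (sigma n) ≤ hsNorm s p f :=
  (hsNorm_le_iff hp).1 le_rfl r hr

theorem hsNorm_sum_le {s : ℕ} {p : ℝ} (hp : 1 ≤ p) {ι : Type*} (t : Finset ι) (c : ι → ℂ)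
    {F : ι → Cn n → ℂ} (hF : ∀ i ∈ t, DifferentiableOn ℂ (F i) (unitBall n)) :
    hsNorm s p (fun z => ∑ i ∈ t, c i * F i z) ≤ ∑ i ∈ t, ‖c i‖ₑ * hsNorm s p (F i) := by
  refine (hsNorm_le_iff hp).2 fun r hr => ?_
  have h : slice s (fun z => ∑ i ∈ t, c i * F i z) r = ∑ i ∈ t, c i • slice s (F i) r := by
    ext ζ
    rw [slice, iterate_idAddRadial_sum t c hF s (smul_sphere_mem_unitBall hr ζ)]
    simp [slice]
  rw [h]
  refine (eLpNorm_sum_le (fun i hi => ?_) (by simpa using hp)).trans ?_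
  · exact ((continuous_slice (hF i hi) s hr).const_smul (c i)).aestronglyMeasurable
  · refine Finset.sum_le_sum fun i _ => ?_
    rw [eLpNorm_const_smul]
    gcongr
    exact eLpNorm_slice_le hp _ hr

theorem hsNorm_const_mul_le {s : ℕ} {p : ℝ} (hp : 1 ≤ p) (c : ℂ)
    {f : Cn n → ℂ} (hf : DifferentiableOn ℂ f (unitBall n)) :
    hsNorm s p (fun z => c * f z) ≤ ‖c‖ₑ * hsNorm s p f := by
  simpa using hsNorm_sum_le (s := s) hp (Finset.univ : Finset Unit) (fun _ => c)
    (F := fun _ => f) (fun _ _ => hf)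

theorem memHS_sum {s : ℕ} {p : ℝ} (hp : 1 ≤ p) {ι : Type*} (t : Finset ι) (c : ι → ℂ)
    {F : ι → Cn n → ℂ} (hF : ∀ i ∈ t, MemHS s p (F i)) :
    MemHS s p (fun z => ∑ i ∈ t, c i * F i z) := by
  refine ⟨DifferentiableOn.fun_sum fun i hi => (hF i hi).1.const_mul _,
    (hsNorm_sum_le hp t c fun i hi => (hF i hi).1).trans_lt ?_⟩
  exact ENNReal.sum_lt_top.2 fun i hi => ENNReal.mul_lt_top enorm_lt_top (hF i hi).2

theorem memHS_one (s : ℕ) {p : ℝ} (hp : 1 ≤ p) : MemHS s p (fun _ : Cn n => (1 : ℂ)) := by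
  refine ⟨differentiableOn_const _, ?_⟩
  refine lt_of_le_of_lt (b := eLpNorm (fun _ => (1 : ℂ)) (ENNReal.ofReal p) (sigma n)) ?_ ?_
  · refine (hsNorm_le_iff hp).2 fun r hr => le_of_eq ?_
    congr 1
    ext ζ
    rw [slice, iterate_idAddRadial_one]
  · exact (memLp_const 1).2

theorem hsNorm_mul_le {s : ℕ} {p : ℝ} {m : Cn n → ℂ} {C : ℝ}
    (hm : multNorm s p m ≤ ENNReal.ofReal C) {h : Cn n → ℂ} (hh : MemHS s p h) :
    hsNorm s p (fun z => m z * h z) ≤ ENNReal.ofReal C * hsNorm s p h := by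
  refine ENNReal.le_of_forall_pos_le_add fun ε hε _ => ?_
  set y := hsNorm s p h with hy
  -- An admissible constant within `ε / (y + 1)` of the bound for the infimum; the `+ 1` covers `y =
  -- 0`.
  obtain ⟨c, hc, hcC⟩ : ∃ c ∈ {c : ℝ≥0∞ | ∀ h : Cn n → ℂ, MemHS s p h →
      hsNorm s p (fun z => m z * h z) ≤ c * hsNorm s p h},
      c < ENNReal.ofReal C + ε / (y + 1) := by
    refine sInf_lt_iff.1 (hm.trans_lt (ENNReal.lt_add_right ENNReal.ofReal_ne_top ?_))
    refine (ENNReal.div_pos (by exact_mod_cast hε.ne') ?_).ne'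
    exact ENNReal.add_ne_top.2 ⟨hh.2.ne, ENNReal.one_ne_top⟩
  refine (hc h hh).trans ((mul_le_mul_left hcC.le _).trans ?_)
  rw [add_mul]
  gcongr
  rw [← hy, ENNReal.div_eq_inv_mul, mul_comm, ← mul_assoc]
  calc y * (y + 1)⁻¹ * ε ≤ 1 * ε := by
        gcongr
        rw [← div_eq_mul_inv]
        exact ENNReal.div_le_of_le_mul (by simp)
    _ = ε := one_mul _

theorem IsMultiplier.differentiableOn {s : ℕ} {p : ℝ} (hp : 1 ≤ p) {m : Cn n → ℂ}
    (hm : IsMultiplier s p m) : DifferentiableOn ℂ m (unitBall n) := by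
  simpa using (hm _ (memHS_one s hp)).1

theorem IsMultiplier.memHS_pow_mul {s : ℕ} {p : ℝ} {m : Cn n → ℂ}
    (hm : IsMultiplier s p m) {h : Cn n → ℂ} (hh : MemHS s p h) (q : ℕ) :
    MemHS s p (fun z => m z ^ q * h z) := by
  induction q with
  | zero => simpa using hh
  | succ q ih => simpa [pow_succ', mul_assoc] using hm _ ih

theorem IsMultiplier.hsNorm_pow_mul_le {s : ℕ} {p : ℝ} {m : Cn n → ℂ} {C : ℝ≥0∞}
    (hm : IsMultiplier s p m)
    (hC : ∀ h, MemHS s p h → hsNorm s p (fun z => m z * h z) ≤ C * hsNorm s p h)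
    {h : Cn n → ℂ} (hh : MemHS s p h) (q : ℕ) :
    hsNorm s p (fun z => m z ^ q * h z) ≤ C ^ q * hsNorm s p h := by
  induction q with
  | zero => simp
  | succ q ih =>
    have := hC _ (hm.memHS_pow_mul hh q)
    simp only [pow_succ', mul_assoc]
    exact this.trans (by gcongr)

/-! ### Point evaluations, and the sup norm of a multiplier -/

/-- A linear isometry of `ℂⁿ` preserves Lebesgue measure. -/
theorem measurePreserving_of_complex (e : Cn n ≃ₗᵢ[ℂ] Cn n) :
    MeasurePreserving (e : Cn n → Cn n) volume volume :=
  LinearIsometryEquiv.measurePreserving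
    (⟨e.toLinearEquiv.restrictScalars ℝ, e.norm_map⟩ : Cn n ≃ₗᵢ[ℝ] Cn n)

theorem measurePreserving_smul_of_norm_eq_one {c : ℂ} (hc : ‖c‖ = 1) :
    MeasurePreserving (fun w : Cn n => c • w) volume volume := by
  have hc0 : c ≠ 0 := norm_ne_zero_iff.1 (by rw [hc]; exact one_ne_zero)
  exact measurePreserving_of_complex
    ⟨LinearEquiv.smulOfNeZero ℂ (Cn n) c hc0, fun w => by simp [norm_smul, hc]⟩

theorem lintegral_eq_lintegral_sphere (hn : 1 ≤ n) {F : Cn n → ℝ≥0∞} (hF : Measurable F) :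
    ∫⁻ z, F z = ∫⁻ r, ∫⁻ ζ, F ((r : ℝ) • (ζ : Cn n)) ∂(sigma n)
      ∂(Measure.volumeIoiPow (Module.finrank ℝ (Cn n) - 1)) := by
  have : Nonempty (Fin n) := ⟨⟨0, hn⟩⟩
  have h1 : ∫⁻ z, F z = ∫⁻ z in ({0}ᶜ : Set (Cn n)), F z := by
    rw [restrict_compl_singleton]
  have h2 := (volume : Measure (Cn n)).measurePreserving_homeomorphUnitSphereProd.lintegral_comp
    (f := fun x => F ((x.2 : ℝ) • (x.1 : Cn n))) (by fun_prop)
  rw [h1, ← lintegral_subtype_comap (measurableSet_singleton _).compl, sigma,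
    ← lintegral_prod_symm' (fun x : Metric.sphere (0 : Cn n) 1 × Set.Ioi (0 : ℝ) =>
      F ((x.2 : ℝ) • (x.1 : Cn n))) (by fun_prop), ← h2]
  refine lintegral_congr fun x => ?_
  rw [← homeomorphUnitSphereProd_symm_apply_coe, Homeomorph.symm_apply_apply]

theorem two_pi_mul_enorm_le_lintegral {g : Cn n → ℂ} (hg : DifferentiableOn ℂ g (unitBall n))
    {z w : Cn n} (hzw : ‖z‖ + ‖w‖ < 1) :
    ENNReal.ofReal (2 * Real.pi) * ‖g z‖ₑ ≤
      ∫⁻ θ in Set.Ioc 0 (2 * Real.pi), ‖g (z + circleMap 0 1 θ • w)‖ₑ := by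
  have hpi : (0 : ℝ) < 2 * Real.pi := by positivity
  have hmem : ∀ t : ℂ, ‖t‖ ≤ 1 → z + t • w ∈ unitBall n := by
    intro t ht
    rw [mem_ball_zero_iff]
    calc ‖z + t • w‖ ≤ ‖z‖ + ‖t‖ * ‖w‖ := by rw [← norm_smul]; exact norm_add_le _ _
      _ ≤ ‖z‖ + 1 * ‖w‖ := by gcongr
      _ < 1 := by linarith
  have hd : DifferentiableOn ℂ (fun t : ℂ => g (z + t • w)) (Metric.closedBall 0 1) := by
    refine hg.comp (by fun_prop) fun t ht => hmem t (by simpa using ht)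
  have h := DiffContOnCl.circleAverage (f := fun t : ℂ => g (z + t • w)) (c := 0) (R := 1)
    (by rw [abs_one]; exact hd.diffContOnCl_ball subset_rfl)
  rw [Real.circleAverage_def, intervalIntegral.integral_of_le hpi.le] at h
  simp only [zero_smul, add_zero] at h
  rw [← h, enorm_smul, ← mul_assoc, Real.enorm_of_nonneg (by positivity),
    ← ENNReal.ofReal_mul hpi.le, mul_inv_cancel₀ hpi.ne', ENNReal.ofReal_one, one_mul]
  exact enorm_integral_le_lintegral_enorm _

/-- Subharmonicity of `|g|`: the mean value inequality on the circles `z + e^{iθ} w` is integrated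
over `w` in the ball, and rotation invariance of volume removes `θ`. -/
theorem enorm_mul_volume_le {g : Cn n → ℂ} (hg : DifferentiableOn ℂ g (unitBall n))
    {z : Cn n} {ρ : ℝ} (hz : ‖z‖ + ρ ≤ 1) :
    ‖g z‖ₑ * volume (Metric.ball (0 : Cn n) ρ) ≤
      ∫⁻ w, (unitBall n).indicator (fun w => ‖g w‖ₑ) w := by
  set G : Cn n → ℝ≥0∞ := (unitBall n).indicator fun w => ‖g w‖ₑ with hG
  have hGm : Measurable G := by
    classical
    rw [hG, ← Set.piecewise_eq_indicator]
    exact hg.continuousOn.enorm.measurable_piecewise continuousOn_const measurableSet_ball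
  set H : Cn n → ℝ≥0∞ := (Metric.ball (0 : Cn n) ρ).indicator fun w => G (z + w) with hH
  have hHm : Measurable H :=
    (hGm.comp (measurable_const_add z)).indicator measurableSet_ball
  have hpi : (0 : ℝ) < 2 * Real.pi := by positivity
  set c := ENNReal.ofReal (2 * Real.pi)
  have hc0 : c ≠ 0 := by simpa [c] using Real.pi_pos
  have h1 : ∀ w, (Metric.ball (0 : Cn n) ρ).indicator (fun _ => c * ‖g z‖ₑ) w ≤
      ∫⁻ θ in Set.Ioc 0 (2 * Real.pi), H (circleMap 0 1 θ • w) := by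
    intro w
    by_cases hw : w ∈ Metric.ball (0 : Cn n) ρ
    swap
    · rw [Set.indicator_of_notMem hw]
      exact zero_le
    rw [Set.indicator_of_mem hw]
    have hw' : ‖w‖ < ρ := by simpa using hw
    refine (two_pi_mul_enorm_le_lintegral hg (by linarith)).trans_eq ?_
    refine lintegral_congr fun θ => ?_
    have hn1 : ‖circleMap 0 1 θ • w‖ = ‖w‖ := by simp [norm_smul]
    rw [hH, Set.indicator_of_mem (by rw [mem_ball_zero_iff, hn1]; exact hw'), hG,
      Set.indicator_of_mem]
    rw [mem_ball_zero_iff]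
    linarith [norm_add_le z (circleMap 0 1 θ • w)]
  have h2 : c * (‖g z‖ₑ * volume (Metric.ball (0 : Cn n) ρ)) ≤ c * ∫⁻ w, H w := by
    calc _ = ∫⁻ w, (Metric.ball (0 : Cn n) ρ).indicator (fun _ => c * ‖g z‖ₑ) w := by
          rw [lintegral_indicator_const measurableSet_ball, mul_assoc]
      _ ≤ ∫⁻ w, ∫⁻ θ in Set.Ioc 0 (2 * Real.pi), H (circleMap 0 1 θ • w) := lintegral_mono h1
      _ = ∫⁻ θ in Set.Ioc 0 (2 * Real.pi), ∫⁻ w, H (circleMap 0 1 θ • w) := by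
          refine lintegral_lintegral_swap (Measurable.aemeasurable ?_)
          refine hHm.comp ?_
          exact ((continuous_circleMap 0 1).measurable.comp measurable_snd).smul measurable_fst
      _ = ∫⁻ θ in Set.Ioc 0 (2 * Real.pi), ∫⁻ w, H w := by
          refine lintegral_congr fun θ => ?_
          exact (measurePreserving_smul_of_norm_eq_one (by simp)).lintegral_comp hHm
      _ = c * ∫⁻ w, H w := by
          rw [lintegral_const, Measure.restrict_apply MeasurableSet.univ, Set.univ_inter,
            Real.volume_Ioc, sub_zero, mul_comm]
  refine ((ENNReal.mul_le_mul_iff_right hc0 ENNReal.ofReal_ne_top).1 h2).trans ?_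
  calc ∫⁻ w, H w ≤ ∫⁻ w, G (z + w) := lintegral_mono fun w => Set.indicator_le_self _ _ _
    _ = _ := lintegral_add_left_eq_self G z

theorem lintegral_indicator_unitBall_le (hn : 1 ≤ n) {g : Cn n → ℂ}
    (hg : DifferentiableOn ℂ g (unitBall n)) {A : ℝ≥0∞}
    (hA : ∀ r ∈ Set.Ico (0 : ℝ) 1, ∫⁻ ζ : Metric.sphere (0 : Cn n) 1,
      ‖g (r • (ζ : Cn n))‖ₑ ∂(sigma n) ≤ A) :
    ∫⁻ w, (unitBall n).indicator (fun w => ‖g w‖ₑ) w ≤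
      A * Measure.volumeIoiPow (Module.finrank ℝ (Cn n) - 1) (Set.Iio ⟨1, by simp⟩) := by
  have hGm : Measurable ((unitBall n).indicator fun w => ‖g w‖ₑ) := by
    classical
    rw [← Set.piecewise_eq_indicator]
    exact hg.continuousOn.enorm.measurable_piecewise continuousOn_const measurableSet_ball
  rw [lintegral_eq_lintegral_sphere hn hGm, ← lintegral_indicator_const measurableSet_Iio]
  refine lintegral_mono fun r => ?_
  have hr0 : (0 : ℝ) < r := r.2
  have hnorm : ∀ ζ : Metric.sphere (0 : Cn n) 1, ‖(r : ℝ) • (ζ : Cn n)‖ = r := fun ζ => by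
    rw [norm_smul, norm_eq_of_mem_sphere, mul_one, Real.norm_of_nonneg hr0.le]
  by_cases hr : (r : ℝ) < 1
  · rw [Set.indicator_of_mem (by exact hr)]
    refine (lintegral_mono fun ζ => Set.indicator_le_self _ _ _).trans (hA r ⟨hr0.le, hr⟩)
  · refine le_of_eq_of_le ?_ zero_le
    refine (lintegral_congr fun ζ => ?_).trans lintegral_zero
    rw [Set.indicator_of_notMem]
    rw [mem_ball_zero_iff, hnorm]
    exact hr

/-- The derivative of `t f(tz)` in `t` is `((I + R) f)(tz)`, so `f(z)` is the mean of `(I + R) f`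
over the segment from `0` to `z`. -/
theorem norm_le_of_norm_idAddRadial_le {f : Cn n → ℂ} (hf : DifferentiableOn ℂ f (unitBall n))
    {r B : ℝ} (hr : r < 1) (h : ∀ z ∈ Metric.closedBall (0 : Cn n) r, ‖idAddRadial f z‖ ≤ B) :
    ∀ z ∈ Metric.closedBall (0 : Cn n) r, ‖f z‖ ≤ B := by
  intro z hz
  have hmem : ∀ t ∈ Set.Icc (0 : ℝ) 1, (t : ℂ) • z ∈ Metric.closedBall (0 : Cn n) r := by
    intro t ht
    rw [mem_closedBall_zero_iff] at hz ⊢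
    rw [norm_smul, Complex.norm_of_nonneg ht.1]
    calc t * ‖z‖ ≤ 1 * ‖z‖ := by gcongr; exact ht.2
      _ ≤ r := by rwa [one_mul]
  have hd : ∀ t ∈ Set.Icc (0 : ℝ) 1,
      HasDerivAt (fun t : ℝ => (t : ℂ) * f ((t : ℂ) • z)) (idAddRadial f ((t : ℂ) • z)) t := by
    intro t ht
    have h1 : HasDerivAt (fun t : ℂ => t • z) z (t : ℂ) := by
      simpa using (hasDerivAt_id (t : ℂ)).smul_const z
    have h2 := (differentiableAt_of_mem_unitBall hf
      (Metric.closedBall_subset_ball hr (hmem t ht))).hasFDerivAt.comp_hasDerivAt (t : ℂ) h1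
    have h3 := ((hasDerivAt_id (t : ℂ)).mul h2).comp_ofReal
    rw [idAddRadial_eq]
    simpa [Function.comp_def] using h3
  have := norm_image_sub_le_of_norm_deriv_le_segment_01'
    (fun t ht => (hd t ht).hasDerivWithinAt)
    (fun t ht => h _ (hmem t ⟨ht.1, ht.2.le⟩))
  simpa using this

theorem norm_le_of_norm_iterate_idAddRadial_le {f : Cn n → ℂ}
    (hf : DifferentiableOn ℂ f (unitBall n)) {r B : ℝ} (hr : r < 1) (s : ℕ)
    (h : ∀ z ∈ Metric.closedBall (0 : Cn n) r, ‖(idAddRadial^[s] f) z‖ ≤ B) :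
    ∀ z ∈ Metric.closedBall (0 : Cn n) r, ‖f z‖ ≤ B := by
  induction s generalizing f with
  | zero => exact h
  | succ s ih =>
    exact norm_le_of_norm_idAddRadial_le hf hr (ih (differentiableOn_idAddRadial hf) h)

/-- The value at `z` is dominated by the volume integral over the ball, which polar coordinates
reduce to `L^1` norms on spheres; these are at most a constant times `L^p` norms since `sigma n` is
finite. -/
theorem exists_norm_iterate_le_mul_hsNorm (hn : 1 ≤ n) (s : ℕ) {p : ℝ} (hp : 1 ≤ p) {r : ℝ}
    (hr : r < 1) : ∃ E : ℝ, 0 ≤ E ∧ ∀ f : Cn n → ℂ, MemHS s p f →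
      ∀ z ∈ Metric.closedBall (0 : Cn n) r,
        ‖(idAddRadial^[s] f) z‖ ≤ E * (hsNorm s p f).toReal := by
  set ρ := 1 - r
  have hρ : 0 < ρ := by simp only [ρ]; linarith
  set v := volume (Metric.ball (0 : Cn n) ρ)
  have hv : v ≠ 0 := (Metric.measure_ball_pos _ _ hρ).ne'
  have hv' : v ≠ ∞ := measure_ball_lt_top.ne
  set c := (sigma n Set.univ ^ (1 / (1 : ℝ≥0∞).toReal - 1 / (ENNReal.ofReal p).toReal)) *
    Measure.volumeIoiPow (Module.finrank ℝ (Cn n) - 1) (Set.Iio ⟨1, by simp⟩)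
  have hc : c ≠ ∞ := by
    refine ENNReal.mul_ne_top (ENNReal.rpow_ne_top_of_nonneg ?_ (measure_ne_top _ _)) ?_
    · rw [ENNReal.toReal_one, ENNReal.toReal_ofReal (by linarith), sub_nonneg]
      exact one_div_le_one_div_of_le one_pos hp
    · rw [Measure.volumeIoiPow_apply_Iio]
      exact ENNReal.ofReal_ne_top
  refine ⟨(c / v).toReal, ENNReal.toReal_nonneg, fun f hf z hz => ?_⟩
  have hg := differentiableOn_iterate_idAddRadial hf.1 s
  have h1 := enorm_mul_volume_le hg (z := z) (ρ := ρ) (by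
    rw [mem_closedBall_zero_iff] at hz; simp only [ρ]; linarith)
  have h2 := h1.trans (lintegral_indicator_unitBall_le hn hg (A := hsNorm s p f *
    (sigma n Set.univ ^ (1 / (1 : ℝ≥0∞).toReal - 1 / (ENNReal.ofReal p).toReal))) ?_)
  · rw [mul_assoc, ← ENNReal.le_div_iff_mul_le (Or.inl hv) (Or.inl hv')] at h2
    have h3 := ENNReal.toReal_mono (ENNReal.div_ne_top (ENNReal.mul_ne_top hf.2.ne hc) hv) h2
    rw [toReal_enorm] at h3
    refine h3.trans_eq ?_
    rw [← ENNReal.toReal_mul, mul_div_assoc, mul_comm]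
  · intro r hr
    have h3 := eLpNorm_le_eLpNorm_mul_rpow_measure_univ (p := 1) (q := ENNReal.ofReal p)
      (by simpa using hp) (continuous_slice hf.1 s hr).aestronglyMeasurable (μ := sigma n)
    rw [eLpNorm_one_eq_lintegral_enorm] at h3
    exact h3.trans (by gcongr; exact eLpNorm_slice_le hp f hr)

theorem exists_norm_le_mul_hsNorm (hn : 1 ≤ n) (s : ℕ) {p : ℝ} (hp : 1 ≤ p) {r : ℝ}
    (hr : r < 1) : ∃ E : ℝ, 0 ≤ E ∧ ∀ f : Cn n → ℂ, MemHS s p f →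
      ∀ z ∈ Metric.closedBall (0 : Cn n) r, ‖f z‖ ≤ E * (hsNorm s p f).toReal := by
  obtain ⟨E, hE, h⟩ := exists_norm_iterate_le_mul_hsNorm hn s hp hr
  exact ⟨E, hE, fun f hf => norm_le_of_norm_iterate_idAddRadial_le hf.1 hr s (h f hf)⟩

/-- Power trick: evaluating `m^q · 1` at `z` gives `|m(z)|^q ≤ C^q B` with `B` independent of `q`,
which forces `|m(z)| ≤ C` as `q` grows. -/
theorem norm_le_of_multNorm_le (hn : 1 ≤ n) {s : ℕ} {p : ℝ} (hp : 1 ≤ p) {m : Cn n → ℂ} {C : ℝ}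
    (hC : 0 ≤ C) (hm : IsMultiplier s p m) (hmC : multNorm s p m ≤ ENNReal.ofReal C) {z : Cn n}
    (hz : z ∈ unitBall n) : ‖m z‖ ≤ C := by
  obtain ⟨E, hE, h⟩ := exists_norm_le_mul_hsNorm hn s hp (mem_ball_zero_iff.1 hz)
  set B := E * (hsNorm s p (fun _ : Cn n => (1 : ℂ))).toReal
  have hq : ∀ q : ℕ, ‖m z‖ ^ q ≤ C ^ q * B := by
    intro q
    have h1 := h _ (hm.memHS_pow_mul (memHS_one s hp) q) z (by simp)
    have h2 := ENNReal.toReal_mono (ENNReal.mul_ne_top (by simp) (memHS_one s hp).2.ne)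
      (hm.hsNorm_pow_mul_le (fun h hh => hsNorm_mul_le hmC hh) (memHS_one s hp) q)
    rw [ENNReal.toReal_mul, ENNReal.toReal_pow, ENNReal.toReal_ofReal hC] at h2
    rw [norm_mul, norm_pow, norm_one, mul_one] at h1
    calc _ ≤ _ := h1
      _ ≤ E * (C ^ q * (hsNorm s p fun _ : Cn n => (1 : ℂ)).toReal) := by gcongr
      _ = _ := by simp only [B]; ring
  by_contra! hlt
  rcases hC.eq_or_lt with rfl | hC0
  · have := hq 1
    simp only [pow_one, zero_mul] at this
    linarith
  · have h1 : 1 < ‖m z‖ / C := (one_lt_div hC0).2 hlt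
    obtain ⟨q, hq'⟩ := ((tendsto_pow_atTop_atTop_of_one_lt h1).eventually_gt_atTop B).exists
    have := hq q
    rw [div_pow, lt_div_iff₀ (by positivity)] at hq'
    linarith

/-! ### The main estimate -/

/-- Hölder with exponents `p` and `p' = p / (p - 1)`. The second factor is at most one because `x k
≤ 1` and `m p' ≥ 2` give `x k ^ (m p') ≤ x k ^ 2`. For `p = 1` only `x k ≤ 1` is needed. -/
theorem sum_pow_mul_le_of_sum_sq_le_one {κ : Type*} [Fintype κ] {m : ℕ} {p : ℝ} (hp : 1 ≤ p)
    (hmp : 2 * (p - 1) ≤ m * p) {x y : κ → ℝ} (hx : ∀ k, 0 ≤ x k) (hy : ∀ k, 0 ≤ y k)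
    (hx2 : ∑ k, x k ^ 2 ≤ 1) : ∑ k, x k ^ m * y k ≤ (∑ k, y k ^ p) ^ (1 / p) := by
  have hx1 : ∀ k, x k ≤ 1 := fun k => by
    have h := (Finset.single_le_sum (fun i _ => sq_nonneg (x i)) (Finset.mem_univ k)).trans hx2
    exact (sq_le_one_iff₀ (hx k)).1 h
  rcases hp.eq_or_lt with rfl | hp1
  · simp only [Real.rpow_one, div_one]
    exact Finset.sum_le_sum fun k _ =>
      mul_le_of_le_one_left (hy k) (pow_le_one₀ (hx k) (hx1 k))
  · have hpq : p.HolderConjugate (p / (p - 1)) := Real.HolderConjugate.conjExponent hp1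
    have h := Real.inner_le_Lp_mul_Lq_of_nonneg Finset.univ hpq (f := y) (g := fun k => x k ^ m)
      (fun k _ => hy k) (fun k _ => by have := hx k; positivity)
    calc ∑ k, x k ^ m * y k = ∑ k, y k * x k ^ m := by simp only [mul_comm]
      _ ≤ _ := h
      _ ≤ (∑ k, y k ^ p) ^ (1 / p) * 1 := by
        refine mul_le_mul_of_nonneg_left ?_ (Real.rpow_nonneg (Finset.sum_nonneg fun k _ => by
          have := hy k; positivity) _)
        refine Real.rpow_le_one (Finset.sum_nonneg fun k _ => ?_) ?_ ?_
        · have := hx k; positivity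
        · refine le_trans (Finset.sum_le_sum fun k _ => ?_) hx2
          rw [← Real.rpow_natCast, ← Real.rpow_mul (hx k), ← Real.rpow_natCast (x k) 2]
          refine Real.rpow_le_rpow_of_exponent_ge_of_imp (hx k) (hx1 k) ?_ ?_
          · rw [← mul_div_assoc, le_div_iff₀ (by linarith)]
            simpa using hmp
          -- The exponent must not vanish at base `0`, as `0 ^ 0 = 1`; `m = 0` would contradict
          -- `hmp` since `p > 1`.
          · intro _ h
            norm_num at h
            rcases h with rfl | h | h
            · norm_num at hmp
              linarith
            · linarith
            · linarith
        · exact (div_pos one_pos hpq.symm.pos).le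
      _ = _ := mul_one _

theorem sum_pow_mul_le {κ : Type*} [Fintype κ] {m : ℕ} {p C : ℝ} (hp : 1 ≤ p) (hC : 0 < C)
    (hmp : 2 * (p - 1) ≤ m * p) {x y : κ → ℝ} (hx : ∀ k, 0 ≤ x k) (hy : ∀ k, 0 ≤ y k)
    (hx2 : ∑ k, x k ^ 2 ≤ C ^ 2) :
    ∑ k, x k ^ m * y k ≤ C ^ m * (∑ k, y k ^ p) ^ (1 / p) := by
  have h := sum_pow_mul_le_of_sum_sq_le_one hp hmp (x := fun k => x k / C)
    (fun k => div_nonneg (hx k) hC.le) hy (by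
      simp only [div_pow]
      rw [← Finset.sum_div]
      exact div_le_one_of_le₀ hx2 (by positivity))
  calc ∑ k, x k ^ m * y k = C ^ m * ∑ k, (x k / C) ^ m * y k := by
        rw [Finset.mul_sum]
        refine Finset.sum_congr rfl fun k _ => ?_
        rw [div_pow]
        field_simp
    _ ≤ _ := by gcongr

theorem eLpNorm_rpow_sum_rpow_le {α κ : Type*} [MeasurableSpace α] [Fintype κ] {ν : Measure α}
    {p A : ℝ} (hp : 1 ≤ p) (hA : 0 ≤ A) (c : κ → ℂ) {v : κ → α → ℂ}
    (hv : ∀ k, AEStronglyMeasurable (v k) ν)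
    (hvA : ∀ k, eLpNorm (v k) (ENNReal.ofReal p) ν ≤ ENNReal.ofReal A) :
    eLpNorm (fun x => (∑ k, (‖c k‖ * ‖v k x‖) ^ p) ^ (1 / p)) (ENNReal.ofReal p) ν ≤
      ENNReal.ofReal (A * (∑ k, ‖c k‖ ^ p) ^ (1 / p)) := by
  have hp0 : 0 < p := by linarith
  have hi : ∀ {w : α → ℂ}, eLpNorm w (ENNReal.ofReal p) ν = (∫⁻ x, ‖w x‖ₑ ^ p ∂ν) ^ (1 / p) := by
    intro w
    rw [eLpNorm_eq_lintegral_rpow_enorm_toReal (by simpa using hp0) ENNReal.ofReal_ne_top,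
      ENNReal.toReal_ofReal hp0.le]
  rw [eLpNorm_eq_lintegral_rpow_enorm_toReal (by simpa using hp0) ENNReal.ofReal_ne_top,
    ENNReal.toReal_ofReal hp0.le]
  have h1 : ∀ x, ‖(∑ k, (‖c k‖ * ‖v k x‖) ^ p) ^ (1 / p)‖ₑ ^ p =
      ∑ k, ‖c k‖ₑ ^ p * ‖v k x‖ₑ ^ p := by
    intro x
    have h0 : 0 ≤ ∑ k, (‖c k‖ * ‖v k x‖) ^ p := Finset.sum_nonneg fun k _ => by positivity
    rw [Real.enorm_of_nonneg (by positivity), ENNReal.ofReal_rpow_of_nonneg (by positivity) hp0.le,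
      ← Real.rpow_mul h0, one_div_mul_cancel hp0.ne', Real.rpow_one,
      ENNReal.ofReal_sum_of_nonneg fun k _ => by positivity]
    refine Finset.sum_congr rfl fun k _ => ?_
    rw [← ENNReal.ofReal_rpow_of_nonneg (by positivity) hp0.le,
      ENNReal.ofReal_mul (norm_nonneg _), ofReal_norm, ofReal_norm,
      ENNReal.mul_rpow_of_nonneg _ _ hp0.le]
  simp only [h1]
  rw [lintegral_finsetSum' _ fun k _ => ((hv k).enorm.pow_const p).const_mul _, one_div,
    ENNReal.rpow_inv_le_iff hp0]
  have h2 : ∀ k, ∫⁻ x, ‖c k‖ₑ ^ p * ‖v k x‖ₑ ^ p ∂ν ≤ ‖c k‖ₑ ^ p * ENNReal.ofReal A ^ p := by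
    intro k
    rw [lintegral_const_mul'' _ ((hv k).enorm.pow_const p)]
    gcongr
    have := hvA k
    rwa [hi, one_div, ENNReal.rpow_inv_le_iff hp0] at this
  refine (Finset.sum_le_sum fun k _ => h2 k).trans_eq ?_
  have h0 : 0 ≤ ∑ k, ‖c k‖ ^ p := Finset.sum_nonneg fun k _ => by positivity
  rw [← Finset.sum_mul, ENNReal.ofReal_rpow_of_nonneg hA hp0.le,
    ENNReal.ofReal_rpow_of_nonneg (by positivity) hp0.le, Real.mul_rpow hA (by positivity), ← Real.rpow_mul h0,
    inv_mul_cancel₀ hp0.ne', Real.rpow_one, mul_comm, ENNReal.ofReal_mul (by positivity),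
    ENNReal.ofReal_sum_of_nonneg fun k _ => by positivity]
  congr 1
  refine Finset.sum_congr rfl fun k _ => ?_
  rw [← ENNReal.ofReal_rpow_of_nonneg (by positivity) hp0.le, ofReal_norm]

/-- The interpolation identity turns each summand into products `g^{l-q} (I + R)^s (g^q e)`, to
which Hölder applies on every sphere. Only the square sum of the `g k` and the norms of `g^q e`
enter, hence a constant independent of the number of terms. -/
theorem exists_hsNorm_sum_pow_mul_le (n s l : ℕ) {p C A : ℝ} (hp : 1 ≤ p) (hC : 0 < C)
    (hA : 0 ≤ A) (hsl : s < l) (hl : 2 * (p - 1) ≤ ((l : ℝ) - s) * p) :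
    ∃ K : ℝ, 0 < K ∧ ∀ (κ : Type) [Fintype κ] (g e : κ → Cn n → ℂ),
      (∀ k, DifferentiableOn ℂ (g k) (unitBall n)) →
      (∀ k, DifferentiableOn ℂ (e k) (unitBall n)) →
      (∀ z ∈ unitBall n, ∑ k, ‖g k z‖ ^ 2 ≤ C ^ 2) →
      (∀ k, ∀ q ≤ s, hsNorm s p (fun z => g k z ^ q * e k z) ≤ ENNReal.ofReal A) →
      ∀ μ : κ → ℂ, hsNorm s p (fun z => ∑ k, μ k * g k z ^ l * e k z) ≤
        ENNReal.ofReal (K * (∑ k, ‖μ k‖ ^ p) ^ (1 / p)) := by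
  obtain ⟨c, hc⟩ := exists_iterate_idAddRadial_pow_mul_eq_sum n s l hsl.le
  set B : ℕ → ℝ := fun q => ‖c q‖ * C ^ (l - q) with hB
  have hB0 : ∀ q, 0 ≤ B q := fun q => by positivity
  have hBs : 0 ≤ ∑ q ∈ Finset.range (s + 1), B q := Finset.sum_nonneg fun q _ => hB0 q
  -- The summand `1` only ensures that the constant is positive.
  refine ⟨(∑ q ∈ Finset.range (s + 1), B q) * A + 1, by positivity,
    fun κ _ g e hg he hg2 hge μ => (hsNorm_le_iff hp).2 fun r hr => ?_⟩
  set w : ℕ → κ → Metric.sphere (0 : Cn n) 1 → ℂ :=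
    fun q k => slice s (fun z => g k z ^ q * e k z) r with hw
  have hwc : ∀ q k, Continuous (w q k) := fun q k =>
    continuous_slice (((hg k).pow q).mul (he k)) s hr
  set N : ℕ → Metric.sphere (0 : Cn n) 1 → ℝ :=
    fun q ζ => (∑ k, (‖μ k‖ * ‖w q k ζ‖) ^ p) ^ (1 / p) with hN
  set S := (∑ k, ‖μ k‖ ^ p) ^ (1 / p) with hS
  have hS0 : 0 ≤ S := Real.rpow_nonneg (Finset.sum_nonneg fun k _ => by positivity) _
  have hNle : ∀ q ≤ s, eLpNorm (N q) (ENNReal.ofReal p) (sigma n) ≤ ENNReal.ofReal (A * S) :=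
    fun q hq => eLpNorm_rpow_sum_rpow_le hp hA μ
      (fun k => (hwc q k).aestronglyMeasurable)
      (fun k => (eLpNorm_slice_le hp _ hr).trans (hge k q hq))
  have hNc : ∀ q, Continuous (N q) := by
    intro q
    refine Continuous.rpow_const ?_ fun ζ => Or.inr (by positivity)
    refine continuous_finsetSum _ fun k _ => ?_
    refine Continuous.rpow_const ?_ fun ζ => Or.inr (by positivity)
    exact continuous_const.mul (hwc q k).norm
  have hpt : ∀ ζ, ‖slice s (fun z => ∑ k, μ k * g k z ^ l * e k z) r ζ‖ ≤
      ‖(∑ q ∈ Finset.range (s + 1), B q • N q) ζ‖ := by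
    intro ζ
    have hz := smul_sphere_mem_unitBall hr ζ
    have h1 : slice s (fun z => ∑ k, μ k * g k z ^ l * e k z) r ζ =
        ∑ q ∈ Finset.range (s + 1), c q * ∑ k, μ k * (g k (r • (ζ : Cn n)) ^ (l - q) * w q k ζ) := by
      have h2 := iterate_idAddRadial_sum Finset.univ μ (F := fun k z => g k z ^ l * e k z)
        (fun k _ => ((hg k).pow l).mul (he k)) s hz
      simp only [← mul_assoc] at h2
      rw [slice, h2]
      simp only [Finset.mul_sum]
      rw [Finset.sum_comm]
      refine Finset.sum_congr rfl fun k _ => ?_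
      rw [hc (g k) (e k) (hg k) (he k) hz, Finset.mul_sum]
      refine Finset.sum_congr rfl fun q _ => ?_
      simp only [hw, slice]
      ring
    rw [h1, Finset.sum_apply]
    refine (norm_sum_le _ _).trans (le_trans (Finset.sum_le_sum fun q hq => ?_) (le_abs_self _))
    rw [Finset.mem_range] at hq
    have hgC : ∀ k, ‖g k (r • (ζ : Cn n))‖ ≤ C := fun k => by
      have := (Finset.single_le_sum (fun i _ => sq_nonneg ‖g i (r • (ζ : Cn n))‖)
        (Finset.mem_univ k)).trans (hg2 _ hz)
      exact (pow_le_pow_iff_left₀ (norm_nonneg _) hC.le two_ne_zero).1 this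
    -- The factor `|g k|^(s - q)` is bounded by `C^(s - q)`; the remaining power `l - s`, the same
    -- for all `q`, goes into Hölder's inequality.
    have hlq : l - q = (l - s) + (s - q) := by lia
    have h3 := sum_pow_mul_le hp hC (m := l - s) (by rwa [Nat.cast_sub hsl.le])
      (x := fun k => ‖g k (r • (ζ : Cn n))‖) (y := fun k => ‖μ k‖ * ‖w q k ζ‖)
      (fun k => norm_nonneg _) (fun k => by positivity) (hg2 _ hz)
    rw [norm_mul, Pi.smul_apply, smul_eq_mul, hB, mul_assoc]
    gcongr
    calc ‖∑ k, μ k * (g k (r • (ζ : Cn n)) ^ (l - q) * w q k ζ)‖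
        ≤ ∑ k, C ^ (s - q) * (‖g k (r • (ζ : Cn n))‖ ^ (l - s) * (‖μ k‖ * ‖w q k ζ‖)) := by
          refine (norm_sum_le _ _).trans (Finset.sum_le_sum fun k _ => ?_)
          rw [norm_mul, norm_mul, norm_pow, hlq, pow_add]
          calc _ = ‖g k (r • (ζ : Cn n))‖ ^ (s - q) *
                (‖g k (r • (ζ : Cn n))‖ ^ (l - s) * (‖μ k‖ * ‖w q k ζ‖)) := by ring
            _ ≤ _ := by gcongr; exact hgC k
      _ ≤ C ^ (s - q) * (C ^ (l - s) * N q ζ) := by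
          rw [← Finset.mul_sum]
          gcongr
      _ = C ^ (l - q) * N q ζ := by rw [hlq, pow_add]; ring
  refine (eLpNorm_mono hpt).trans ((eLpNorm_sum_le
    (fun q _ => ((hNc q).const_smul _).aestronglyMeasurable) (by simpa using hp)).trans ?_)
  calc ∑ q ∈ Finset.range (s + 1), eLpNorm (B q • N q) (ENNReal.ofReal p) (sigma n)
      ≤ ∑ q ∈ Finset.range (s + 1), ENNReal.ofReal (B q * (A * S)) := by
        refine Finset.sum_le_sum fun q hq => ?_
        rw [eLpNorm_const_smul, Real.enorm_of_nonneg (hB0 q), ENNReal.ofReal_mul (hB0 q)]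
        gcongr
        exact hNle q (by rw [Finset.mem_range] at hq; lia)
    _ = ENNReal.ofReal (∑ q ∈ Finset.range (s + 1), B q * (A * S)) :=
        (ENNReal.ofReal_sum_of_nonneg fun q _ => by
          have := hB0 q; positivity).symm
    _ ≤ _ := by
        refine ENNReal.ofReal_le_ofReal ?_
        rw [← Finset.sum_mul]
        nlinarith

/-! ### The discrete Fourier transform and canonical dual sequences -/

section Fourier

variable {N : ℕ} {θ : ℂ}

theorem sum_fin_pow_mul_pow (hθ : IsPrimitiveRoot θ N) (i k : Fin N) :
    ∑ j : Fin N, θ⁻¹ ^ ((j : ℕ) * (k : ℕ)) * θ ^ ((j : ℕ) * (i : ℕ)) =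
      if i = k then (N : ℂ) else 0 := by
  have hN : N ≠ 0 := (Fin.pos i).ne'
  have hθ0 : θ ≠ 0 := hθ.ne_zero hN
  set ω : ℂ := θ⁻¹ ^ (k : ℕ) * θ ^ (i : ℕ) with hω
  have h1 : ∀ j : Fin N, θ⁻¹ ^ ((j : ℕ) * (k : ℕ)) * θ ^ ((j : ℕ) * (i : ℕ)) = ω ^ (j : ℕ) := by
    intro j
    rw [hω, mul_pow, ← pow_mul, ← pow_mul, mul_comm (j : ℕ), mul_comm (j : ℕ)]
  simp only [h1]
  split_ifs with hik
  · have : ω = 1 := by rw [hω, hik, ← mul_pow, inv_mul_cancel₀ hθ0, one_pow]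
    simp [this]
  · have hne : ω ≠ 1 := by
      intro h
      rw [hω, inv_pow, inv_mul_eq_one₀ (pow_ne_zero _ hθ0)] at h
      exact hik (Fin.ext (hθ.pow_inj k.2 i.2 h).symm)
    have hN1 : ω ^ N = 1 := by
      rw [hω, mul_pow, ← pow_mul, ← pow_mul, mul_comm, mul_comm (i : ℕ), pow_mul, hθ.pow_eq_one,
        mul_comm (k : ℕ), pow_mul, inv_pow, hθ.pow_eq_one]
      simp
    rw [Fin.sum_univ_eq_sum_range fun j => ω ^ j, geom_sum_eq hne, hN1, sub_self, zero_div]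

/-- Parseval: expanding the square and summing over `k` first leaves only the diagonal, by
orthogonality of characters. -/
theorem sum_norm_sq_fourier (hθ : IsPrimitiveRoot θ N) (b : Fin N → ℂ) :
    ∑ k : Fin N, ‖∑ j : Fin N, θ⁻¹ ^ ((j : ℕ) * (k : ℕ)) * b j‖ ^ 2 = N * ∑ j, ‖b j‖ ^ 2 := by
  rcases eq_or_ne N 0 with rfl | hN
  · simp
  have hθ1 : ‖θ‖ = 1 := hθ.norm'_eq_one hN
  have hconj : (starRingEnd ℂ) θ⁻¹ = θ := by
    rw [← Complex.inv_eq_conj (by rw [norm_inv, hθ1, inv_one]), inv_inv]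
  have hsq : ∀ x : ℂ, ((‖x‖ ^ 2 : ℝ) : ℂ) = (starRingEnd ℂ) x * x := fun x => by
    rw [Complex.conj_mul', Complex.ofReal_pow]
  apply Complex.ofReal_injective
  rw [Complex.ofReal_sum, Complex.ofReal_mul, Complex.ofReal_sum]
  simp only [hsq, map_sum, map_mul, map_pow, hconj, Finset.sum_mul_sum]
  rw [Finset.sum_comm, Finset.mul_sum]
  refine Finset.sum_congr rfl fun i _ => ?_
  rw [Finset.sum_comm]
  have : ∀ j : Fin N, ∑ k : Fin N, θ ^ ((i : ℕ) * (k : ℕ)) * (starRingEnd ℂ) (b i) *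
      (θ⁻¹ ^ ((j : ℕ) * (k : ℕ)) * b j) =
      (starRingEnd ℂ) (b i) * b j * if i = j then (N : ℂ) else 0 := by
    intro j
    rw [← sum_fin_pow_mul_pow hθ i j, Finset.mul_sum]
    refine Finset.sum_congr rfl fun k _ => ?_
    rw [mul_comm (k : ℕ), mul_comm (k : ℕ)]
    ring
  simp only [this, mul_ite, mul_zero, Finset.sum_ite_eq, Finset.mem_univ, if_true]
  rw [Complex.ofReal_natCast]
  ring

end Fourier

theorem isPrimitiveRoot_exp_div {N : ℕ} (hN : N ≠ 0) :
    IsPrimitiveRoot (Complex.exp (2 * Real.pi * Complex.I / N)) N :=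
  Complex.isPrimitiveRoot_exp N hN

theorem exists_isCanonicalDual {s : ℕ} {p C : ℝ} (hC : 0 ≤ C) {N : ℕ} {a : Fin N → Cn n}
    (h : InterpolatesMult s p a C) : ∃ γ, IsCanonicalDual s p a C γ := by
  set θ := Complex.exp (2 * Real.pi * Complex.I / N) with hθdef
  have hθ1 : ∀ m : ℕ, ‖θ ^ m‖ ≤ 1 := by
    intro m
    rcases eq_or_ne N 0 with rfl | hN
    · simp [hθdef]
    · rw [norm_pow, (isPrimitiveRoot_exp_div hN).norm'_eq_one hN, one_pow]
  have hβ : ∀ j : Fin N, ∃ m : Cn n → ℂ, IsMultiplier s p m ∧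
      multNorm s p m ≤ ENNReal.ofReal C ∧ ∀ k, m (a k) = θ ^ ((j : ℕ) * (k : ℕ)) := by
    intro j
    have hmem : Memℓp (fun k : Fin N => θ ^ ((j : ℕ) * (k : ℕ))) ∞ :=
      memℓp_infty ⟨1, by rintro _ ⟨k, rfl⟩; exact hθ1 _⟩
    obtain ⟨m, hm, hma, hmC⟩ := h ⟨_, hmem⟩
    refine ⟨m, hm, hmC.trans (ENNReal.ofReal_le_ofReal ?_), hma⟩
    refine mul_le_of_le_one_right hC (lp.norm_le_of_forall_le zero_le_one fun k => hθ1 _)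
  choose β hm hmC hma using hβ
  exact ⟨_, β, fun j => ⟨hm j, hmC j, hma j⟩, fun k z => rfl⟩

section CanonicalDual

variable {s : ℕ} {p C : ℝ} {N : ℕ} {a : Fin N → Cn n} {γ : Fin N → Cn n → ℂ}

theorem IsCanonicalDual.apply_eq (hγ : IsCanonicalDual s p a C γ) (k i : Fin N) :
    γ k (a i) = if i = k then 1 else 0 := by
  obtain ⟨β, hβ, hγβ⟩ := hγ
  have hN : N ≠ 0 := (Fin.pos i).ne'
  rw [hγβ]
  simp only [(hβ _).2.2]
  rw [sum_fin_pow_mul_pow (isPrimitiveRoot_exp_div hN)]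
  split_ifs
  · rw [one_div_mul_cancel (Nat.cast_ne_zero.2 hN)]
  · rw [mul_zero]

theorem IsCanonicalDual.sum_norm_sq_le (hn : 1 ≤ n) (hp : 1 ≤ p) (hC : 0 ≤ C)
    (hγ : IsCanonicalDual s p a C γ) {z : Cn n} (hz : z ∈ unitBall n) :
    ∑ k, ‖γ k z‖ ^ 2 ≤ C ^ 2 := by
  obtain ⟨β, hβ, hγβ⟩ := hγ
  rcases eq_or_ne N 0 with rfl | hN
  · simp; positivity
  have hN' : (N : ℝ) ≠ 0 := Nat.cast_ne_zero.2 hN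
  simp only [hγβ, norm_mul, mul_pow]
  rw [← Finset.mul_sum, sum_norm_sq_fourier (isPrimitiveRoot_exp_div hN)]
  have h1 : ∑ j, ‖β j z‖ ^ 2 ≤ N * C ^ 2 := by
    refine (Finset.sum_le_sum fun j _ => ?_).trans_eq (b := ∑ _j : Fin N, C ^ 2) (by simp)
    have := norm_le_of_multNorm_le hn hp hC (hβ j).1 (hβ j).2.1 hz
    gcongr
  calc _ ≤ ‖1 / (N : ℂ)‖ ^ 2 * (N * (N * C ^ 2)) := by gcongr
    _ = C ^ 2 := by
      rw [norm_div, norm_one, Complex.norm_natCast]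
      field_simp

theorem IsCanonicalDual.mul_eq_sum {β : Fin N → Cn n → ℂ}
    (hγβ : ∀ k z, γ k z = (1 / (N : ℂ)) * ∑ j : Fin N,
      (Complex.exp (2 * Real.pi * Complex.I / N))⁻¹ ^ ((j : ℕ) * (k : ℕ)) * β j z)
    (k : Fin N) (h : Cn n → ℂ) : (fun z => γ k z * h z) = fun z => ∑ j : Fin N,
      ((1 / (N : ℂ)) * (Complex.exp (2 * Real.pi * Complex.I / N))⁻¹ ^ ((j : ℕ) * (k : ℕ))) *
        (β j z * h z) := by
  ext z
  rw [hγβ, Finset.mul_sum, Finset.sum_mul]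
  exact Finset.sum_congr rfl fun j _ => by ring

theorem IsCanonicalDual.isMultiplier (hp : 1 ≤ p) (hγ : IsCanonicalDual s p a C γ) (k : Fin N) :
    IsMultiplier s p (γ k) := by
  obtain ⟨β, hβ, hγβ⟩ := hγ
  intro h hh
  rw [IsCanonicalDual.mul_eq_sum hγβ]
  exact memHS_sum hp _ _ fun j _ => (hβ j).1 h hh

/-- Each `γ k` is an average of the `β j` with unimodular coefficients, so it inherits their bound
without loss. -/
theorem IsCanonicalDual.hsNorm_mul_le (hp : 1 ≤ p) (hγ : IsCanonicalDual s p a C γ) (k : Fin N)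
    {h : Cn n → ℂ} (hh : MemHS s p h) :
    hsNorm s p (fun z => γ k z * h z) ≤ ENNReal.ofReal C * hsNorm s p h := by
  obtain ⟨β, hβ, hγβ⟩ := hγ
  have hN : N ≠ 0 := (Fin.pos k).ne'
  rw [IsCanonicalDual.mul_eq_sum hγβ]
  refine (hsNorm_sum_le hp _ _ fun j _ => ((hβ j).1 h hh).1).trans ?_
  have h1 : ∀ j : Fin N, ‖(1 / (N : ℂ)) *
      (Complex.exp (2 * Real.pi * Complex.I / N))⁻¹ ^ ((j : ℕ) * (k : ℕ))‖ₑ = (N : ℝ≥0∞)⁻¹ := by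
    intro j
    rw [← ofReal_norm, norm_mul, norm_pow, norm_inv,
      (isPrimitiveRoot_exp_div hN).norm'_eq_one hN, inv_one, one_pow, mul_one, norm_div, norm_one,
      Complex.norm_natCast, one_div, ENNReal.ofReal_inv_of_pos (by positivity),
      ENNReal.ofReal_natCast]
  calc _ ≤ ∑ _j : Fin N, (N : ℝ≥0∞)⁻¹ * (ENNReal.ofReal C * hsNorm s p h) := by
        refine Finset.sum_le_sum fun j _ => ?_
        rw [h1]
        gcongr
        exact HardySobolev.hsNorm_mul_le (hβ j).2.1 hh
    _ = _ := by
        rw [Finset.sum_const, Finset.card_univ, Fintype.card_fin, nsmul_eq_mul, ← mul_assoc,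
          ENNReal.mul_inv_cancel (by simpa using hN) (by simp), one_mul]

end CanonicalDual

/-- The functions `e k` are left arbitrary so that both the normalised kernels and the functions
`peak` can be inserted. -/
theorem exists_forall_isCanonicalDual_hsNorm_sum_le (hn : 1 ≤ n) (s l : ℕ) {p C A : ℝ}
    (hp : 1 ≤ p) (hC : 0 < C) (hA : 0 ≤ A) (hsl : s < l) (hl : 2 * (p - 1) ≤ ((l : ℝ) - s) * p) :
    ∃ K : ℝ, 0 < K ∧ ∀ (N : ℕ) (a : Fin N → Cn n) (γ e : Fin N → Cn n → ℂ),
      IsCanonicalDual s p a C γ →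
      (∀ k, DifferentiableOn ℂ (e k) (unitBall n)) →
      (∀ k, hsNorm s p (e k) ≤ ENNReal.ofReal A) → ∀ μ : Fin N → ℂ,
        MemHS s p (fun z => ∑ k, μ k * γ k z ^ l * e k z) ∧
        hsNorm s p (fun z => ∑ k, μ k * γ k z ^ l * e k z) ≤
          ENNReal.ofReal (K * (∑ k, ‖μ k‖ ^ p) ^ (1 / p)) ∧
        ∀ i, ∑ k, μ k * γ k (a i) ^ l * e k (a i) = μ i * e i (a i) := by
  -- The constant `(max 1 C) ^ s * A` dominates the norms `C ^ q * A` of `γ k ^ q * e k` for all `q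
  -- ≤ s` at once.
  obtain ⟨K, hK, h⟩ := exists_hsNorm_sum_pow_mul_le n s l (A := (max 1 C) ^ s * A) hp hC
    (by positivity) hsl hl
  refine ⟨K, hK, fun N a γ e hγ he heA μ => ?_⟩
  have hm := fun k => hγ.isMultiplier hp k
  have hd := fun k => (hm k).differentiableOn hp
  have hle := h (Fin N) γ e hd he (fun z hz => hγ.sum_norm_sq_le hn hp hC.le hz)
    (fun k q hq => by
      have hek : MemHS s p (e k) := ⟨he k, (heA k).trans_lt ENNReal.ofReal_lt_top⟩
      refine ((hm k).hsNorm_pow_mul_le (fun h hh => hγ.hsNorm_mul_le hp k hh) hek q).trans ?_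
      rw [ENNReal.ofReal_mul (by positivity), ← ENNReal.ofReal_pow hC.le]
      gcongr
      · calc C ^ q ≤ (max 1 C) ^ q := by gcongr; exact le_max_right _ _
          _ ≤ (max 1 C) ^ s := pow_le_pow_right₀ (le_max_left _ _) hq
      · exact heA k) μ
  refine ⟨⟨?_, hle.trans_lt ENNReal.ofReal_lt_top⟩, hle, fun i => ?_⟩
  · exact DifferentiableOn.fun_sum fun k _ =>
      (((hd k).pow l).const_mul (μ k)).mul (he k)
  · rw [Finset.sum_eq_single i]
    · simp [hγ.apply_eq]
    · intro k _ hki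
      rw [hγ.apply_eq, if_neg hki.symm, zero_pow (by lia)]
      simp
    · simp

/-! ### Normalised kernels -/

theorem one_sub_inner_re_pos {a z : Cn n} (ha : a ∈ unitBall n) (hz : z ∈ unitBall n) :
    0 < (1 - inner ℂ a z).re := by
  rw [mem_ball_zero_iff] at ha hz
  have h1 := (Complex.re_le_norm (inner ℂ a z)).trans (norm_inner_le_norm a z)
  rw [Complex.sub_re, Complex.one_re]
  nlinarith [norm_nonneg a, norm_nonneg z]

theorem one_sub_inner_ne_zero {a z : Cn n} (ha : a ∈ unitBall n) (hz : z ∈ unitBall n) :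
    (1 : ℂ) - inner ℂ a z ≠ 0 := fun h => by
  simpa [h] using one_sub_inner_re_pos ha hz

theorem differentiable_inner_right (a : Cn n) : Differentiable ℂ fun z : Cn n => inner ℂ a z :=
  (innerSL ℂ a).differentiable

theorem differentiableOn_kernel (s : ℕ) {a : Cn n} (ha : a ∈ unitBall n) :
    DifferentiableOn ℂ (kernel s a) (unitBall n) := by
  have hd : DifferentiableOn ℂ (fun z : Cn n => 1 - inner ℂ a z) (unitBall n) :=
    ((differentiable_inner_right a).const_sub 1).differentiableOn
  unfold kernel
  split_ifs
  · exact (hd.clog fun z hz => Or.inl (one_sub_inner_re_pos ha hz)).const_sub 1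
  · intro z hz
    exact (hd z hz).zpow (Or.inl (one_sub_inner_ne_zero ha hz))

theorem hsNorm_normKernel_le {s : ℕ} {p : ℝ} (hp : 1 ≤ p) {a : Cn n} (ha : a ∈ unitBall n) :
    hsNorm s p (normKernel s p a) ≤ 1 := by
  have h : normKernel s p a = fun z =>
      ((hsNorm s p (kernel s a)).toReal : ℂ)⁻¹ * kernel s a z := by
    ext z
    rw [normKernel, div_eq_inv_mul]
  rw [h]
  refine (hsNorm_const_mul_le hp _ (differentiableOn_kernel s ha)).trans ?_
  set x := hsNorm s p (kernel s a)
  -- If the norm is `0` or `∞`, its `toReal` is `0`, and division by zero makes the normalised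
  -- kernel vanish.
  by_cases hx : x.toReal = 0
  · simp [hx]
  · have h0 := ENNReal.toReal_ne_zero.1 hx
    rw [← ofReal_norm, norm_inv, Complex.norm_of_nonneg ENNReal.toReal_nonneg,
      ENNReal.ofReal_inv_of_pos (ENNReal.toReal_pos h0.1 h0.2), ENNReal.ofReal_toReal h0.2,
      ENNReal.inv_mul_cancel h0.1 h0.2]

theorem differentiableOn_normKernel (s : ℕ) (p : ℝ) {a : Cn n} (ha : a ∈ unitBall n) :
    DifferentiableOn ℂ (normKernel s p a) (unitBall n) := by
  unfold normKernel
  simp only [div_eq_mul_inv]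
  exact (differentiableOn_kernel s ha).mul_const _

/-! ### Non-isotropic balls and integrals of powers of `1 - ā·ζ` -/

section Pointwise

open scoped Pointwise

/-- Uniqueness of Haar measure gives proportionality to the product measure; the value of the
constant is not needed. -/
theorem exists_volume_setOf_forall_mem (n : ℕ) : ∃ c : ℝ≥0∞, c ≠ ∞ ∧ ∀ t : Fin n → Set ℂ,
    (∀ i, MeasurableSet (t i)) → volume {v : Cn n | ∀ i, v i ∈ t i} = c * ∏ i, volume (t i) := by
  let L : Cn n ≃L[ℝ] (Fin n → ℂ) := PiLp.continuousLinearEquiv 2 ℝ fun _ => ℂ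
  have : (Measure.map L (volume : Measure (Cn n))).IsAddHaarMeasure :=
    L.isAddHaarMeasure_map volume
  refine ⟨Measure.addHaarScalarFactor (Measure.map L (volume : Measure (Cn n))) volume,
    ENNReal.coe_ne_top, fun t ht => ?_⟩
  have h : {v : Cn n | ∀ i, v i ∈ t i} = L ⁻¹' Set.univ.pi t := by
    ext v
    simp [L]
  rw [h, ← Measure.map_apply L.continuous.measurable (MeasurableSet.univ_pi ht), ← volume_pi_pi]
  exact congrArg (· (Set.univ.pi t))
    (Measure.isAddLeftInvariant_eq_smul (Measure.map L (volume : Measure (Cn n))) volume)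

theorem volume_peak_le {m : ℕ} : ∃ c : ℝ≥0∞, c ≠ ∞ ∧ ∀ a ∈ unitBall (m + 1), 1 / 2 ≤ ‖a‖ →
    ∀ δ : ℝ, 0 < δ → volume {w : Cn (m + 1) | ‖w‖ < 1 ∧ ‖1 - inner ℂ a w‖ < 2 * δ} ≤
      c * ENNReal.ofReal (δ ^ (m + 2)) := by
  obtain ⟨c, hc, hvol⟩ := exists_volume_setOf_forall_mem (m + 1)
  refine ⟨c * (ENNReal.ofReal (16 * 9 ^ m) * NNReal.pi ^ (m + 1)), ?_, fun a ha ha2 δ hδ => ?_⟩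
  · exact ENNReal.mul_ne_top hc (ENNReal.mul_ne_top ENNReal.ofReal_ne_top
      (ENNReal.pow_ne_top ENNReal.coe_ne_top))
  have ha0 : 0 < ‖a‖ := by linarith
  have ha1 : ‖a‖ < 1 := mem_ball_zero_iff.1 ha
  set u : Cn (m + 1) := ((‖a‖⁻¹ : ℝ) : ℂ) • a with hu
  have hu1 : ‖u‖ = 1 := by
    rw [hu, norm_smul, Complex.norm_of_nonneg (by positivity), inv_mul_cancel₀ ha0.ne']
  have hau : a = (‖a‖ : ℂ) • u := by
    rw [hu, smul_smul, ← Complex.ofReal_mul, mul_inv_cancel₀ ha0.ne', Complex.ofReal_one, one_smul]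
  obtain ⟨b, hb⟩ := Orthonormal.exists_orthonormalBasis_extension_of_card_eq (𝕜 := ℂ)
    (ι := Fin (m + 1)) (by simp) (v := fun _ => u) (s := {0}) (by
      refine ⟨fun i => hu1, fun i j hij => (hij (Subsingleton.elim i j)).elim⟩)
  have hb0 : b 0 = u := hb 0 rfl
  -- In an orthonormal basis starting with `a/|a|` the region lies in this polydisc. Division by
  -- `|a| ≥ 1/2` turns `2δ` into `4δ`. The first coordinate has modulus above `1 - 2δ`, so the
  -- others have squared modulus below `4δ`, hence below `9δ`.
  let t : Fin (m + 1) → Set ℂ := Fin.cons (Metric.ball ((‖a‖⁻¹ : ℝ) : ℂ) (4 * δ))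
    fun _ => Metric.ball 0 (3 * √δ)
  have ht : ∀ i, MeasurableSet (t i) := by
    intro i
    refine Fin.cases ?_ (fun j => ?_) i
    · exact measurableSet_ball
    · exact measurableSet_ball
  have hsub : {w : Cn (m + 1) | ‖w‖ < 1 ∧ ‖1 - inner ℂ a w‖ < 2 * δ} ⊆
      b.repr ⁻¹' {v : Cn (m + 1) | ∀ i, v i ∈ t i} := by
    rintro w ⟨hw1, hw2⟩
    set v := b.repr w with hv
    have hv0 : inner ℂ a w = ‖a‖ * v 0 := by
      rw [hv, b.repr_apply_apply, hb0]
      conv_lhs => rw [hau, inner_smul_left, Complex.conj_ofReal]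
    have hvn : ‖v‖ < 1 := by rw [hv, b.repr.norm_map]; exact hw1
    have hsq : ‖v 0‖ ^ 2 + ∑ i : Fin m, ‖v i.succ‖ ^ 2 < 1 := by
      rw [← Fin.sum_univ_succ fun i => ‖v i‖ ^ 2, ← EuclideanSpace.norm_sq_eq]
      nlinarith [norm_nonneg v]
    rw [hv0] at hw2
    intro i
    refine Fin.cases ?_ (fun j => ?_) i
    · change v 0 ∈ Metric.ball _ _
      rw [mem_ball_iff_norm]
      have h1 : v 0 - ((‖a‖⁻¹ : ℝ) : ℂ) = -((‖a‖⁻¹ : ℝ) : ℂ) * (1 - ‖a‖ * v 0) := by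
        have : (‖a‖ : ℂ) ≠ 0 := Complex.ofReal_ne_zero.2 ha0.ne'
        push_cast
        field_simp
        ring
      rw [h1, norm_mul, norm_neg, Complex.norm_of_nonneg (by positivity), inv_mul_lt_iff₀ ha0]
      nlinarith
    · change v j.succ ∈ Metric.ball _ _
      rw [mem_ball_zero_iff]
      have h1 : 1 - 2 * δ < ‖v 0‖ := by
        have h2 := norm_sub_norm_le (1 : ℂ) (‖a‖ * v 0)
        rw [norm_one, norm_mul, Complex.norm_of_nonneg ha0.le] at h2
        nlinarith [norm_nonneg (v 0)]
      have h2 : ‖v j.succ‖ ^ 2 ≤ ∑ i : Fin m, ‖v i.succ‖ ^ 2 :=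
        Finset.single_le_sum (f := fun i : Fin m => ‖v i.succ‖ ^ 2)
          (fun i _ => sq_nonneg _) (Finset.mem_univ j)
      have h3 : ‖v j.succ‖ ^ 2 < (3 * √δ) ^ 2 := by
        rw [mul_pow, Real.sq_sqrt hδ.le]
        nlinarith [norm_nonneg (v 0), sq_nonneg (1 - ‖v 0‖)]
      exact lt_of_pow_lt_pow_left₀ 2 (by positivity) h3
  refine (measure_mono hsub).trans ?_
  have hpre : volume (b.repr ⁻¹' {v : Cn (m + 1) | ∀ i, v i ∈ t i}) =
      volume {v : Cn (m + 1) | ∀ i, v i ∈ t i} :=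
    MeasurePreserving.measure_preimage_equiv (f := b.repr.toHomeomorph.toMeasurableEquiv)
      (measurePreserving_of_complex b.repr) _
  rw [hpre, hvol t ht]
  rw [Fin.prod_univ_succ]
  simp only [t, Fin.cons_zero, Fin.cons_succ, Complex.volume_ball, Finset.prod_const,
    Finset.card_univ, Fintype.card_fin]
  rw [mul_assoc c]
  refine mul_le_mul_right ?_ c
  rw [← ENNReal.ofReal_pow (by positivity), ← ENNReal.ofReal_pow (by positivity), mul_pow (3 : ℝ),
    Real.sq_sqrt hδ.le, mul_pow (ENNReal.ofReal _), ← ENNReal.ofReal_pow (by positivity)]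
  refine le_of_eq ?_
  calc _ = (ENNReal.ofReal ((4 * δ) ^ 2) * ENNReal.ofReal ((3 ^ 2 * δ) ^ m)) *
      (NNReal.pi : ℝ≥0∞) ^ (m + 1) := by ring
    _ = ENNReal.ofReal (16 * 9 ^ m * δ ^ (m + 2)) * (NNReal.pi : ℝ≥0∞) ^ (m + 1) := by
      rw [← ENNReal.ofReal_mul (by positivity)]
      congr 2
      ring
    _ = _ := by
      rw [ENNReal.ofReal_mul (by positivity)]
      ring

/-- The non-isotropic ball of radius `δ` with centre `a`, cut with the unit sphere. -/
def peakSet (a : Cn n) (δ : ℝ) : Set (Metric.sphere (0 : Cn n) 1) :=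
  {ζ | ‖(1 : ℂ) - inner ℂ a (ζ : Cn n)‖ < δ}

theorem measurableSet_peakSet (a : Cn n) (δ : ℝ) : MeasurableSet (peakSet a δ) := by
  refine IsOpen.measurableSet (isOpen_lt ?_ continuous_const)
  exact (continuous_const.sub (continuous_const.inner continuous_subtype_val)).norm

/-- Points of the cone of radius below `1 - δ` lie in the shrunken cone. The others are within `δ`
of the sphere, which moves `ā·ζ` by at most `δ`. -/
theorem cone_peakSet_subset {a : Cn n} (ha : a ∈ unitBall n) {δ : ℝ} (hδ1 : δ < 1) :
    Set.Ioo (0 : ℝ) 1 • (Subtype.val '' peakSet a δ) ⊆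
      (1 - δ) • (Set.Ioo (0 : ℝ) 1 • (Subtype.val '' peakSet a δ)) ∪
        {w : Cn n | ‖w‖ < 1 ∧ ‖1 - inner ℂ a w‖ < 2 * δ} := by
  rintro _ ⟨r, hr, _, ⟨ζ, hζ, rfl⟩, rfl⟩
  by_cases h : r < 1 - δ
  · left
    have h1 : 0 < 1 - δ := by linarith
    refine ⟨(r / (1 - δ)) • (ζ : Cn n), ⟨r / (1 - δ), ⟨div_pos hr.1 h1, (div_lt_one h1).2 h⟩,
      (ζ : Cn n), ⟨ζ, hζ, rfl⟩, rfl⟩, ?_⟩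
    simp only [smul_smul]
    rw [mul_div_cancel₀ _ h1.ne']
  · right
    push Not at h
    refine ⟨?_, ?_⟩
    · simp only [norm_smul, norm_eq_of_mem_sphere, mul_one]
      rw [Real.norm_of_nonneg hr.1.le]
      exact hr.2
    · have h1 : (1 : ℂ) - inner ℂ a (r • (ζ : Cn n)) =
          (1 - inner ℂ a (ζ : Cn n)) + ((1 - r : ℝ) : ℂ) * inner ℂ a (ζ : Cn n) := by
        rw [← Complex.coe_smul r (ζ : Cn n), inner_smul_right]
        push_cast
        ring
      have h2 : ‖inner ℂ a (ζ : Cn n)‖ ≤ 1 := by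
        refine (norm_inner_le_norm a (ζ : Cn n)).trans ?_
        rw [norm_eq_of_mem_sphere, mul_one]
        exact (mem_ball_zero_iff.1 ha).le
      simp only [h1]
      refine (norm_add_le _ _).trans_lt ?_
      rw [norm_mul, Complex.norm_of_nonneg (by linarith [hr.2])]
      have h3 : ‖(1 : ℂ) - inner ℂ a (ζ : Cn n)‖ < δ := hζ
      have h4 : (1 - r) * ‖inner ℂ a (ζ : Cn n)‖ ≤ δ * 1 := by
        have := (norm_nonneg _).trans_lt h3
        gcongr
        linarith
      linarith

/-- Shrinking by `1 - δ` multiplies the volume by at most `1 - δ`, so at least the fraction `δ` of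
the cone lies in the outer layer. This passes from a volume bound of order `δ^(n+1)` to a surface
bound of order `δ^n`. -/
theorem mul_volume_cone_le (hn : 1 ≤ n) {a : Cn n} (ha : a ∈ unitBall n) {δ : ℝ} (hδ : 0 < δ)
    (hδ1 : δ < 1) :
    ENNReal.ofReal δ * volume (Set.Ioo (0 : ℝ) 1 • (Subtype.val '' peakSet a δ)) ≤
      volume {w : Cn n | ‖w‖ < 1 ∧ ‖1 - inner ℂ a w‖ < 2 * δ} := by
  set A := Set.Ioo (0 : ℝ) 1 • (Subtype.val '' peakSet a δ)
  have : Nonempty (Fin n) := ⟨⟨0, hn⟩⟩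
  have hA : volume A ≠ ∞ := by
    refine ((measure_mono (t := Metric.ball 0 1) ?_).trans_lt measure_ball_lt_top).ne
    rintro _ ⟨r, hr, _, ⟨ζ, hζ, rfl⟩, rfl⟩
    exact smul_sphere_mem_unitBall ⟨hr.1.le, hr.2⟩ ζ
  have h1 := (measure_mono (μ := volume) (cone_peakSet_subset ha hδ1)).trans (measure_union_le _ _)
  rw [Measure.addHaar_smul_of_nonneg _ (by linarith)] at h1
  have h2 : ENNReal.ofReal ((1 - δ) ^ Module.finrank ℝ (Cn n)) ≤ ENNReal.ofReal (1 - δ) :=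
    ENNReal.ofReal_le_ofReal
      (pow_le_of_le_one (by linarith) (by linarith) Module.finrank_pos.ne')
  have h3 : volume A = ENNReal.ofReal δ * volume A + ENNReal.ofReal (1 - δ) * volume A := by
    rw [← add_mul, ← ENNReal.ofReal_add hδ.le (by linarith)]
    simp
  have h4 : ENNReal.ofReal (1 - δ) * volume A ≠ ∞ := ENNReal.mul_ne_top ENNReal.ofReal_ne_top hA
  refine (ENNReal.add_le_add_iff_right h4).1 ?_
  rw [← h3, add_comm]
  exact h1.trans (by gcongr)

theorem exists_sigma_peakSet_le (hn : 1 ≤ n) : ∃ c : ℝ≥0∞, c ≠ ∞ ∧ ∀ a ∈ unitBall n,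
    ∀ δ : ℝ, 0 < δ → sigma n (peakSet a δ) ≤ c * ENNReal.ofReal (δ ^ n) := by
  obtain ⟨m, rfl⟩ : ∃ m, n = m + 1 := ⟨n - 1, by lia⟩
  obtain ⟨c, hc, h⟩ := volume_peak_le (m := m)
  refine ⟨sigma (m + 1) Set.univ * ENNReal.ofReal (2 ^ (m + 1)) +
    Module.finrank ℝ (Cn (m + 1)) * c, ?_, fun a ha δ hδ => ?_⟩
  · exact ENNReal.add_ne_top.2 ⟨ENNReal.mul_ne_top (measure_ne_top _ _) ENNReal.ofReal_ne_top,
      ENNReal.mul_ne_top (ENNReal.natCast_ne_top _) hc⟩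
  rw [add_mul]
  -- For `δ ≥ 1/2` the total mass suffices. For smaller `δ` the set is empty when `|a| < 1/2`, which
  -- leaves the case of the volume estimate.
  rcases le_or_gt (1 / 2) δ with hδ2 | hδ2
  · refine le_add_right ?_
    rw [mul_assoc, ← ENNReal.ofReal_mul (by positivity), ← mul_pow]
    calc sigma (m + 1) (peakSet a δ) ≤ sigma (m + 1) Set.univ * 1 := by
          rw [mul_one]; exact measure_mono (Set.subset_univ _)
      _ ≤ _ := by
        gcongr
        rw [ENNReal.one_le_ofReal]
        exact one_le_pow₀ (by linarith)
  refine le_add_left ?_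
  rcases lt_or_ge ‖a‖ (1 / 2) with ha2 | ha2
  · have : peakSet a δ = ∅ := by
      refine Set.eq_empty_iff_forall_notMem.2 fun ζ hζ => ?_
      have h1 : ‖(1 : ℂ) - inner ℂ a (ζ : Cn (m + 1))‖ < δ := hζ
      have h2 := norm_sub_norm_le (1 : ℂ) (inner ℂ a (ζ : Cn (m + 1)))
      have h3 := norm_inner_le_norm (𝕜 := ℂ) a (ζ : Cn (m + 1))
      rw [norm_eq_of_mem_sphere, mul_one] at h3
      rw [norm_one] at h2
      linarith
    simp [this]
  · have h1 := (mul_volume_cone_le hn ha hδ (by linarith)).trans (h a ha ha2 δ hδ)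
    rw [sigma, Measure.toSphere_apply' _ (measurableSet_peakSet a δ), mul_assoc]
    gcongr
    have h2 : c * ENNReal.ofReal (δ ^ (m + 2)) =
        ENNReal.ofReal δ * (c * ENNReal.ofReal (δ ^ (m + 1))) := by
      rw [pow_succ' δ (m + 1), ENNReal.ofReal_mul hδ.le]
      ring
    rw [h2] at h1
    exact (ENNReal.mul_le_mul_iff_right (by simpa using hδ) ENNReal.ofReal_ne_top).1 h1

end Pointwise

theorem one_sub_norm_le_norm_one_sub_inner (a : Cn n) (ζ : Metric.sphere (0 : Cn n) 1) :
    1 - ‖a‖ ≤ ‖(1 : ℂ) - inner ℂ a (ζ : Cn n)‖ := by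
  have h2 := norm_sub_norm_le (1 : ℂ) (inner ℂ a (ζ : Cn n))
  have h3 := norm_inner_le_norm (𝕜 := ℂ) a (ζ : Cn n)
  rw [norm_eq_of_mem_sphere, mul_one] at h3
  rw [norm_one] at h2
  linarith

/-- Dyadic decomposition at the scales `2^i (1 - |a|)`: the exponent `n + 1` against measure of
order `δ^n` gives a geometric series of ratio `1/2`. -/
theorem exists_lintegral_inv_pow_le (hn : 1 ≤ n) : ∃ B : ℝ≥0∞, B ≠ ∞ ∧ ∀ a ∈ unitBall n,
    ∫⁻ ζ : Metric.sphere (0 : Cn n) 1,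
      ENNReal.ofReal ((‖(1 : ℂ) - inner ℂ a (ζ : Cn n)‖ ^ (n + 1))⁻¹) ∂(sigma n) ≤
        B * ENNReal.ofReal (1 - ‖a‖)⁻¹ := by
  obtain ⟨c, hc, h⟩ := exists_sigma_peakSet_le hn
  refine ⟨c * ENNReal.ofReal (2 ^ n) * 2, by finiteness, fun a ha => ?_⟩
  set η := 1 - ‖a‖ with hηdef
  have hη : 0 < η := by
    have := mem_ball_zero_iff.1 ha
    linarith
  have hpt : ∀ ζ : Metric.sphere (0 : Cn n) 1,
      ENNReal.ofReal ((‖(1 : ℂ) - inner ℂ a (ζ : Cn n)‖ ^ (n + 1))⁻¹) ≤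
      ∑' i : ℕ, (peakSet a (2 ^ (i + 1) * η)).indicator
        (fun _ => ENNReal.ofReal (((2 ^ i * η) ^ (n + 1))⁻¹)) ζ := by
    intro ζ
    set X := ‖(1 : ℂ) - inner ℂ a (ζ : Cn n)‖ with hX
    have hX1 : 1 ≤ X / η := (one_le_div hη).2 (one_sub_norm_le_norm_one_sub_inner a ζ)
    obtain ⟨i, hi1, hi2⟩ := exists_nat_pow_near hX1 (one_lt_two)
    rw [le_div_iff₀ hη] at hi1
    rw [div_lt_iff₀ hη] at hi2
    refine le_trans ?_ (ENNReal.le_tsum i)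
    rw [Set.indicator_of_mem (show ζ ∈ peakSet a (2 ^ (i + 1) * η) from hi2)]
    exact ENNReal.ofReal_le_ofReal (by gcongr)
  refine (lintegral_mono hpt).trans ?_
  rw [lintegral_tsum fun i =>
    (measurable_const.indicator (measurableSet_peakSet a _)).aemeasurable]
  have hterm : ∀ i : ℕ, ∫⁻ ζ, (peakSet a (2 ^ (i + 1) * η)).indicator
      (fun _ => ENNReal.ofReal (((2 ^ i * η) ^ (n + 1))⁻¹)) ζ ∂(sigma n) ≤
      c * ENNReal.ofReal (2 ^ n) * ENNReal.ofReal η⁻¹ * 2⁻¹ ^ i := by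
    intro i
    rw [lintegral_indicator_const (measurableSet_peakSet a _)]
    calc _ ≤ ENNReal.ofReal (((2 ^ i * η) ^ (n + 1))⁻¹) *
          (c * ENNReal.ofReal ((2 ^ (i + 1) * η) ^ n)) := by
          gcongr
          exact h a ha _ (by positivity)
      _ = c * ENNReal.ofReal (2 ^ n * η⁻¹ * (2 ^ i)⁻¹) := by
          rw [mul_left_comm, ← ENNReal.ofReal_mul (by positivity)]
          congr 2
          field_simp
          ring_nf
      _ = _ := by
          have hi : ENNReal.ofReal ((2 ^ i)⁻¹) = 2⁻¹ ^ i := by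
            rw [ENNReal.ofReal_inv_of_pos (by positivity), ENNReal.ofReal_pow two_pos.le,
              ENNReal.ofReal_ofNat, ENNReal.inv_pow]
          rw [ENNReal.ofReal_mul (by positivity), ENNReal.ofReal_mul (by positivity), hi]
          ring
  refine (ENNReal.tsum_le_tsum hterm).trans_eq ?_
  rw [ENNReal.tsum_mul_left, ENNReal.tsum_geometric, ENNReal.one_sub_inv_two, inv_inv]
  ring

/-- The surplus power `t - (n + 1)` is estimated by `|1 - ā·ζ| ≥ 1 - |a|`, which reduces to exponent
`n + 1`. -/
theorem exists_lintegral_rpow_neg_le (hn : 1 ≤ n) {t : ℝ} (ht : n + 1 ≤ t) :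
    ∃ B : ℝ, 0 ≤ B ∧ ∀ a ∈ unitBall n,
      ∫⁻ ζ : Metric.sphere (0 : Cn n) 1,
        ENNReal.ofReal (‖(1 : ℂ) - inner ℂ a (ζ : Cn n)‖ ^ (-t)) ∂(sigma n) ≤
          ENNReal.ofReal (B * (1 - ‖a‖) ^ (n - t)) := by
  obtain ⟨B, hB, h⟩ := exists_lintegral_inv_pow_le hn
  refine ⟨B.toReal, ENNReal.toReal_nonneg, fun a ha => ?_⟩
  set η := 1 - ‖a‖ with hηdef
  have hη : 0 < η := by
    have := mem_ball_zero_iff.1 ha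
    linarith
  have hpt : ∀ ζ : Metric.sphere (0 : Cn n) 1,
      ENNReal.ofReal (‖(1 : ℂ) - inner ℂ a (ζ : Cn n)‖ ^ (-t)) ≤
      ENNReal.ofReal (η ^ (n + 1 - t)) *
        ENNReal.ofReal ((‖(1 : ℂ) - inner ℂ a (ζ : Cn n)‖ ^ (n + 1))⁻¹) := by
    intro ζ
    set X := ‖(1 : ℂ) - inner ℂ a (ζ : Cn n)‖ with hX
    have hηX : η ≤ X := one_sub_norm_le_norm_one_sub_inner a ζ
    have hX0 : 0 < X := hη.trans_le hηX
    rw [← ENNReal.ofReal_mul (by positivity)]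
    refine ENNReal.ofReal_le_ofReal ?_
    have h1 : X ^ (-t) = X ^ (n + 1 - t) * (X ^ (n + 1))⁻¹ := by
      rw [← Real.rpow_natCast, ← Real.rpow_neg hX0.le, ← Real.rpow_add hX0]
      congr 1
      push_cast
      ring
    rw [h1]
    refine mul_le_mul_of_nonneg_right ?_ (by positivity)
    exact Real.rpow_le_rpow_of_nonpos hη hηX (by linarith)
  refine (lintegral_mono hpt).trans ?_
  rw [lintegral_const_mul' _ _ ENNReal.ofReal_ne_top]
  refine (mul_le_mul_right (h a ha) _).trans_eq ?_
  rw [ENNReal.ofReal_mul ENNReal.toReal_nonneg, ENNReal.ofReal_toReal hB, mul_left_comm,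
    ← ENNReal.ofReal_mul (by positivity)]
  congr 2
  rw [← Real.rpow_neg_one, ← Real.rpow_add hη]
  congr 1
  ring

/-! ### Peak functions of bounded norm -/

theorem differentiableOn_inv_one_sub_inner {a : Cn n} (ha : a ∈ unitBall n) :
    DifferentiableOn ℂ (fun z => (1 - inner ℂ a z)⁻¹) (unitBall n) :=
  ((differentiable_inner_right a).const_sub 1).differentiableOn.inv
    fun _ hz => one_sub_inner_ne_zero ha hz

theorem radialDeriv_inv_one_sub_inner {a z : Cn n} (ha : a ∈ unitBall n) (hz : z ∈ unitBall n) :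
    radialDeriv (fun z => (1 - inner ℂ a z)⁻¹) z =
      (1 - inner ℂ a z)⁻¹ ^ 2 - (1 - inner ℂ a z)⁻¹ := by
  have h0 := one_sub_inner_ne_zero ha hz
  have h1 : HasFDerivAt (fun z : Cn n => 1 - inner ℂ a z) (-innerSL ℂ a) z :=
    (innerSL ℂ a).hasFDerivAt.const_sub 1
  have h2 := ((hasDerivAt_inv h0).comp_hasFDerivAt z h1).fderiv
  rw [radialDeriv_eq_fderiv]
  erw [h2]
  simp
  field_simp
  ring

/-- With `g = (1 - ā·z)⁻¹` one has `R g = g^2 - g`, hence `(I + R) g^M = (1 - M) g^M + M g^(M+1)`.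
Since `|g| ≥ 1/2`, the lower power is absorbed in the higher one. -/
theorem exists_norm_iterate_idAddRadial_inv_pow_le (n s : ℕ) : ∀ M : ℕ, ∃ A : ℝ, 0 ≤ A ∧
    ∀ a ∈ unitBall n, ∀ z ∈ unitBall n,
      ‖(idAddRadial^[s] fun z : Cn n => (1 - inner ℂ a z)⁻¹ ^ M) z‖ ≤
        A * ‖(1 - inner ℂ a z)⁻¹‖ ^ (M + s) := by
  induction s with
  | zero => exact fun M => ⟨1, zero_le_one, fun a ha z hz => by simp⟩
  | succ s ih =>
    intro M
    obtain ⟨A, hA, h⟩ := ih M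
    obtain ⟨A', hA', h'⟩ := ih (M + 1)
    refine ⟨‖(1 : ℂ) - M‖ * A * 2 + M * A', by positivity, fun a ha z hz => ?_⟩
    have hd := differentiableOn_inv_one_sub_inner ha
    set g : Cn n → ℂ := fun z => (1 - inner ℂ a z)⁻¹ with hg
    have h1 : Set.EqOn (idAddRadial fun z => g z ^ M)
        (fun z => ∑ i : Fin 2, ![(1 - M : ℂ), M] i * (![fun z => g z ^ M, fun z => g z ^ (M + 1)] :
          Fin 2 → Cn n → ℂ) i z) (unitBall n) := by
      intro w hw
      have h2 := idAddRadial_pow_mul (f := fun _ => 1)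
        (differentiableAt_of_mem_unitBall hd hw) (by fun_prop) M
      have h3 : idAddRadial (fun _ : Cn n => (1 : ℂ)) = fun _ => 1 := iterate_idAddRadial_one 1
      simp only [mul_one] at h2
      have h4 : radialDeriv g w = g w ^ 2 - g w := radialDeriv_inv_one_sub_inner ha hw
      rw [h2, h3, h4]
      rcases M with _ | M
      · simp
      · simp
        ring
    rw [Function.iterate_succ_apply, eqOn_iterate_idAddRadial h1 s hz,
      iterate_idAddRadial_sum Finset.univ _ (by
        simp only [Finset.mem_univ, true_imp_iff, Fin.forall_fin_two]
        exact ⟨hd.pow M, hd.pow (M + 1)⟩) s hz]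
    simp only [Fin.sum_univ_two, Matrix.cons_val_zero, Matrix.cons_val_one]
    have hg2 : 1 ≤ 2 * ‖g z‖ := by
      have h4 : ‖(1 : ℂ) - inner ℂ a z‖ ≤ 2 := by
        have h5 := norm_sub_le (1 : ℂ) (inner ℂ a z)
        have h6 := norm_inner_le_norm (𝕜 := ℂ) a z
        rw [norm_one] at h5
        rw [mem_ball_zero_iff] at ha hz
        nlinarith [norm_nonneg a, norm_nonneg z]
      rw [hg, norm_inv, ← div_eq_mul_inv,
        one_le_div (norm_pos_iff.2 (one_sub_inner_ne_zero ha hz))]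
      exact h4
    refine (norm_add_le _ _).trans ?_
    rw [norm_mul, norm_mul, Complex.norm_natCast, add_mul]
    refine add_le_add ?_ ?_
    · calc _ ≤ ‖(1 : ℂ) - M‖ * (A * ‖g z‖ ^ (M + s) * 1) := by
            rw [mul_one]
            gcongr
            exact h a ha z hz
        _ ≤ ‖(1 : ℂ) - M‖ * (A * ‖g z‖ ^ (M + s) * (2 * ‖g z‖)) := by gcongr
        _ = _ := by ring
    · calc _ ≤ M * (A' * ‖g z‖ ^ (M + 1 + s)) := by
            gcongr
            exact h' a ha z hz
        _ = _ := by ring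

/-- A holomorphic function that peaks at `a` and takes there the value `weight s p a`. -/
def peak (s : ℕ) (p : ℝ) (a : Cn n) : Cn n → ℂ := fun z =>
  (((1 - ‖a‖ ^ 2) ^ ((n + 1 + s : ℝ) - n / p) : ℝ) : ℂ) * (1 - inner ℂ a z)⁻¹ ^ (n + 1)

theorem differentiableOn_peak (s : ℕ) (p : ℝ) {a : Cn n} (ha : a ∈ unitBall n) :
    DifferentiableOn ℂ (peak s p a) (unitBall n) :=
  ((differentiableOn_inv_one_sub_inner ha).pow (n + 1)).const_mul _

theorem one_sub_norm_sq_pos {a : Cn n} (ha : a ∈ unitBall n) : 0 < 1 - ‖a‖ ^ 2 := by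
  rw [mem_ball_zero_iff] at ha
  nlinarith [norm_nonneg a]

theorem peak_self (s : ℕ) (p : ℝ) {a : Cn n} (ha : a ∈ unitBall n) :
    peak s p a a = (weight s p a : ℂ) := by
  have h0 := one_sub_norm_sq_pos ha
  have h1 : (1 : ℂ) - inner ℂ a a = ((1 - ‖a‖ ^ 2 : ℝ) : ℂ) := by
    rw [inner_self_eq_norm_sq_to_K]
    push_cast
    rfl
  rw [peak, h1, weight, ← Complex.ofReal_inv, ← Complex.ofReal_pow, ← Complex.ofReal_mul]
  congr 1
  have h2 : (1 - ‖a‖ ^ 2)⁻¹ ^ (n + 1) = (1 - ‖a‖ ^ 2) ^ (-((n + 1 : ℕ) : ℝ)) := by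
    rw [Real.rpow_neg h0.le, Real.rpow_natCast, inv_pow]
  rw [h2, ← Real.rpow_add h0]
  congr 1
  push_cast
  ring

theorem exists_hsNorm_peak_le (hn : 1 ≤ n) (s : ℕ) {p : ℝ} (hp : 1 ≤ p) :
    ∃ A : ℝ, 0 ≤ A ∧ ∀ a ∈ unitBall n, hsNorm s p (peak s p a) ≤ ENNReal.ofReal A := by
  have hp0 : 0 < p := by linarith
  obtain ⟨A, hA, h⟩ := exists_norm_iterate_idAddRadial_inv_pow_le n s (n + 1)
  set m : ℝ := n + 1 + s with hm
  have hn1 : (1 : ℝ) ≤ n := by exact_mod_cast hn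
  have ht : (n : ℝ) + 1 ≤ m * p := by
    have : (0 : ℝ) ≤ s := by positivity
    nlinarith
  have hmp : 0 ≤ m - n / p := by
    rw [sub_nonneg, div_le_iff₀ hp0]
    linarith
  obtain ⟨B, hB, hFR⟩ := exists_lintegral_rpow_neg_le hn ht
  refine ⟨2 ^ (m - n / p) * (A * B ^ (1 / p)), by positivity, fun a ha => ?_⟩
  have ha1 : 0 < 1 - ‖a‖ := by
    have := mem_ball_zero_iff.1 ha
    linarith
  have h0 := one_sub_norm_sq_pos ha
  have hd := (differentiableOn_inv_one_sub_inner ha).pow (n + 1)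
  have hN : hsNorm s p (fun z => (1 - inner ℂ a z)⁻¹ ^ (n + 1)) ≤
      ENNReal.ofReal (A * (B * (1 - ‖a‖) ^ (n - m * p)) ^ (1 / p)) := by
    refine (hsNorm_le_iff hp).2 fun r hr => ?_
    -- The radius is moved from `ζ` to `a`, so that the integral estimate on the unit sphere applies
    -- with centre `r • a`.
    have hra : r • a ∈ unitBall n := by
      rw [mem_ball_zero_iff] at ha ⊢
      rw [norm_smul, Real.norm_of_nonneg hr.1]
      nlinarith [hr.1, hr.2, norm_nonneg a]
    have hinner : ∀ ζ : Metric.sphere (0 : Cn n) 1,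
        (inner ℂ a (r • (ζ : Cn n)) : ℂ) = inner ℂ (r • a) (ζ : Cn n) := by
      intro ζ
      rw [← Complex.coe_smul r (ζ : Cn n), ← Complex.coe_smul r a, inner_smul_left,
        inner_smul_right, Complex.conj_ofReal]
    rw [eLpNorm_eq_lintegral_rpow_enorm_toReal (by simpa using hp0) ENNReal.ofReal_ne_top,
      ENNReal.toReal_ofReal hp0.le, one_div, ENNReal.rpow_inv_le_iff hp0,
      ENNReal.ofReal_rpow_of_nonneg (by positivity) hp0.le]
    have hpt : ∀ ζ : Metric.sphere (0 : Cn n) 1,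
        ‖slice s (fun z => (1 - inner ℂ a z)⁻¹ ^ (n + 1)) r ζ‖ₑ ^ p ≤
        ENNReal.ofReal (A ^ p) *
          ENNReal.ofReal (‖(1 : ℂ) - inner ℂ (r • a) (ζ : Cn n)‖ ^ (-(m * p))) := by
      intro ζ
      have h1 := h a ha _ (smul_sphere_mem_unitBall hr ζ)
      rw [hinner, norm_inv] at h1
      rw [← ofReal_norm, ENNReal.ofReal_rpow_of_nonneg (norm_nonneg _) hp0.le,
        ← ENNReal.ofReal_mul (by positivity)]
      refine ENNReal.ofReal_le_ofReal ((Real.rpow_le_rpow (norm_nonneg _) h1 hp0.le).trans_eq ?_)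
      rw [Real.mul_rpow hA (by positivity), ← Real.rpow_natCast, ← Real.rpow_neg_one,
        ← Real.rpow_mul (norm_nonneg _), ← Real.rpow_mul (norm_nonneg _)]
      congr 2
      rw [hm]
      push_cast
      ring
    refine (lintegral_mono hpt).trans ?_
    rw [lintegral_const_mul' _ _ ENNReal.ofReal_ne_top]
    refine (mul_le_mul_right (hFR _ hra) _).trans ?_
    rw [← ENNReal.ofReal_mul (by positivity)]
    refine ENNReal.ofReal_le_ofReal ?_
    rw [Real.mul_rpow hA (by positivity), ← Real.rpow_mul (by positivity), inv_mul_cancel₀ hp0.ne',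
      Real.rpow_one]
    have hra1 : 1 - ‖a‖ ≤ 1 - ‖r • a‖ := by
      rw [norm_smul, Real.norm_of_nonneg hr.1]
      nlinarith [hr.2, norm_nonneg a]
    have := Real.rpow_le_rpow_of_nonpos ha1 hra1 (z := n - m * p) (by linarith)
    gcongr
  refine (hsNorm_const_mul_le hp _ hd).trans ?_
  have hw : (0 : ℝ) ≤ (1 - ‖a‖ ^ 2) ^ (m - n / p) := Real.rpow_nonneg h0.le _
  rw [← ofReal_norm, Complex.norm_of_nonneg hw]
  refine (mul_le_mul_right hN _).trans ?_
  rw [← ENNReal.ofReal_mul hw]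
  refine ENNReal.ofReal_le_ofReal ?_
  have h1 : (1 - ‖a‖ ^ 2) ^ (m - n / p) ≤ 2 ^ (m - n / p) * (1 - ‖a‖) ^ (m - n / p) := by
    rw [← Real.mul_rpow two_pos.le ha1.le]
    refine Real.rpow_le_rpow h0.le ?_ hmp
    nlinarith [norm_nonneg a, mem_ball_zero_iff.1 ha]
  have h2 : (B * (1 - ‖a‖) ^ (n - m * p)) ^ (1 / p) =
      B ^ (1 / p) * (1 - ‖a‖) ^ (-(m - n / p)) := by
    rw [Real.mul_rpow hB (by positivity), ← Real.rpow_mul ha1.le]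
    congr 2
    field_simp
    ring
  rw [h2]
  calc _ ≤ (2 ^ (m - n / p) * (1 - ‖a‖) ^ (m - n / p)) *
        (A * (B ^ (1 / p) * (1 - ‖a‖) ^ (-(m - n / p)))) := by gcongr
    _ = 2 ^ (m - n / p) * (A * B ^ (1 / p)) *
        ((1 - ‖a‖) ^ (m - n / p) * (1 - ‖a‖) ^ (-(m - n / p))) := by ring
    _ = _ := by
      rw [← Real.rpow_add ha1, add_neg_cancel, Real.rpow_zero, mul_one]

/-! ### Limits of locally bounded families -/

/-- A family of functions that is uniformly bounded on every smaller concentric ball. -/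
def LocallyBounded {X : Type*} (F : X → Cn n → ℂ) : Prop :=
  ∀ r < 1, ∃ M, ∀ x, ∀ z ∈ Metric.closedBall (0 : Cn n) r, ‖F x z‖ ≤ M

theorem exists_ball_subset_closedBall {z : Cn n} (hz : z ∈ unitBall n) :
    ∃ ρ r : ℝ, 0 < ρ ∧ r < 1 ∧ Metric.ball z ρ ⊆ Metric.closedBall 0 r := by
  rw [mem_ball_zero_iff] at hz
  refine ⟨(1 - ‖z‖) / 2, (1 + ‖z‖) / 2, by linarith, by linarith, fun w hw => ?_⟩
  rw [mem_ball_iff_norm] at hw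
  rw [mem_closedBall_zero_iff]
  linarith [norm_le_norm_add_norm_sub' w z]

section Limit

variable {X : Type*} (U : Ultrafilter X) {F : X → Cn n → ℂ} {f : Cn n → ℂ}

theorem LocallyBounded.comp_idAddRadial (hb : LocallyBounded F)
    (hF : ∀ x, DifferentiableOn ℂ (F x) (unitBall n)) :
    LocallyBounded fun x => idAddRadial (F x) := by
  intro r hr
  obtain ⟨M, hM⟩ := hb ((1 + r) / 2) (by linarith)
  have hρ : 0 < (1 - r) / 2 := by linarith
  refine ⟨M + 2 * M / ((1 - r) / 2), fun x z hz => ?_⟩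
  rw [mem_closedBall_zero_iff] at hz
  have hsub : Metric.ball z ((1 - r) / 2) ⊆ Metric.closedBall 0 ((1 + r) / 2) := by
    intro w hw
    rw [mem_ball_iff_norm] at hw
    rw [mem_closedBall_zero_iff]
    linarith [norm_le_norm_add_norm_sub' w z]
  have hd := norm_fderiv_le_of_bounded hρ
    ((hF x).mono (hsub.trans (Metric.closedBall_subset_ball (by linarith))))
    fun w hw => hM x w (hsub hw)
  simp only [idAddRadial_eq]
  refine (norm_add_le _ _).trans (add_le_add (hM x z ?_) ?_)
  · exact hsub (Metric.mem_ball_self hρ)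
  · calc _ ≤ ‖fderiv ℂ (F x) z‖ * ‖z‖ := ContinuousLinearMap.le_opNorm _ _
      _ ≤ ‖fderiv ℂ (F x) z‖ * 1 := by gcongr; linarith
      _ ≤ _ := by rwa [mul_one]

theorem exists_hasFDerivAt_of_tendsto (hb : LocallyBounded F)
    (hF : ∀ x, DifferentiableOn ℂ (F x) (unitBall n))
    (hf : ∀ z ∈ unitBall n, Tendsto (fun x => F x z) U (𝓝 (f z))) {z : Cn n}
    (hz : z ∈ unitBall n) :
    ∃ L, HasFDerivAt f L z ∧ Tendsto (fun x => fderiv ℂ (F x) z) U (𝓝 L) := by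
  obtain ⟨ρ, r, hρ, hr, hsub⟩ := exists_ball_subset_closedBall hz
  obtain ⟨M, hM⟩ := hb r hr
  have hsub' := hsub.trans (Metric.closedBall_subset_ball hr)
  exact hasFDerivAt_of_tendsto_of_bounded U hρ
    (Eventually.of_forall fun x => (hF x).mono hsub')
    (Eventually.of_forall fun x w hw => hM x w (hsub hw)) fun w hw => hf w (hsub' hw)

theorem differentiableOn_of_tendsto (hb : LocallyBounded F)
    (hF : ∀ x, DifferentiableOn ℂ (F x) (unitBall n))
    (hf : ∀ z ∈ unitBall n, Tendsto (fun x => F x z) U (𝓝 (f z))) :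
    DifferentiableOn ℂ f (unitBall n) := fun z hz => by
  obtain ⟨L, hL, -⟩ := exists_hasFDerivAt_of_tendsto U hb hF hf hz
  exact hL.differentiableAt.differentiableWithinAt

theorem tendsto_idAddRadial (hb : LocallyBounded F)
    (hF : ∀ x, DifferentiableOn ℂ (F x) (unitBall n))
    (hf : ∀ z ∈ unitBall n, Tendsto (fun x => F x z) U (𝓝 (f z))) :
    ∀ z ∈ unitBall n, Tendsto (fun x => idAddRadial (F x) z) U (𝓝 (idAddRadial f z)) := by
  intro z hz
  obtain ⟨L, hL, hlim⟩ := exists_hasFDerivAt_of_tendsto U hb hF hf hz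
  simp only [idAddRadial_eq, hL.fderiv]
  exact (hf z hz).add (((ContinuousLinearMap.apply ℂ ℂ z).continuous.tendsto L).comp hlim)

theorem tendsto_iterate_idAddRadial (hb : LocallyBounded F)
    (hF : ∀ x, DifferentiableOn ℂ (F x) (unitBall n))
    (hf : ∀ z ∈ unitBall n, Tendsto (fun x => F x z) U (𝓝 (f z))) (s : ℕ) :
    (LocallyBounded fun x => idAddRadial^[s] (F x)) ∧
    ∀ z ∈ unitBall n, Tendsto (fun x => (idAddRadial^[s] (F x)) z) U
      (𝓝 ((idAddRadial^[s] f) z)) := by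
  induction s generalizing F f with
  | zero => exact ⟨hb, hf⟩
  | succ s ih =>
    exact ih (hb.comp_idAddRadial hF) (fun x => differentiableOn_idAddRadial (hF x))
      (tendsto_idAddRadial U hb hF hf)

/-- Equicontinuity on the compact sphere upgrades pointwise convergence along an ultrafilter to
uniform convergence. -/
theorem equicontinuous_slice {s : ℕ} {r : ℝ} (hr : r ∈ Set.Ico (0 : ℝ) 1)
    (hb : LocallyBounded fun x => idAddRadial^[s] (F x))
    (hF : ∀ x, DifferentiableOn ℂ (F x) (unitBall n)) :
    Equicontinuous fun x => slice s (F x) r := by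
  intro (ζ : Metric.sphere (0 : Cn n) 1)
  obtain ⟨ρ, r', hρ, hr', hsub⟩ := exists_ball_subset_closedBall (smul_sphere_mem_unitBall hr ζ)
  obtain ⟨M, hM⟩ := hb r' hr'
  have hc : Continuous fun ξ : Metric.sphere (0 : Cn n) 1 => r • (ξ : Cn n) := by fun_prop
  refine Metric.equicontinuousAt_of_continuity_modulus
    (fun ξ : Metric.sphere (0 : Cn n) 1 => 2 * M / ρ * ‖r • (ξ : Cn n) - r • (ζ : Cn n)‖) ?_ _ ?_
  · have : Continuous fun ξ : Metric.sphere (0 : Cn n) 1 =>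
        2 * M / ρ * ‖r • (ξ : Cn n) - r • (ζ : Cn n)‖ := by fun_prop
    simpa using this.tendsto ζ
  · filter_upwards [hc.tendsto ζ (Metric.ball_mem_nhds _ hρ)] with ξ hξ
    intro x
    rw [dist_comm, dist_eq_norm]
    exact norm_sub_le_of_bounded ((differentiableOn_iterate_idAddRadial (hF x) s).mono
      (hsub.trans (Metric.closedBall_subset_ball hr'))) (fun w hw => hM x w (hsub hw)) hξ

/-- Fatou's lemma needs a sequence. On each sphere the convergence is uniform, so a sequence of
members of the family converging to the limit can be selected, even though the ultrafilter need not
be countably generated. -/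
theorem hsNorm_le_of_tendsto {s : ℕ} {p : ℝ} (hp : 1 ≤ p) (hb : LocallyBounded F)
    (hF : ∀ x, DifferentiableOn ℂ (F x) (unitBall n))
    (hf : ∀ z ∈ unitBall n, Tendsto (fun x => F x z) U (𝓝 (f z))) {B : ℝ≥0∞}
    (hB : ∀ x, hsNorm s p (F x) ≤ B) : hsNorm s p f ≤ B := by
  refine (hsNorm_le_iff hp).2 fun r hr => ?_
  obtain ⟨hbs, hlim⟩ := tendsto_iterate_idAddRadial U hb hF hf s
  have hpi : Tendsto (fun x => slice s (F x) r) U (𝓝 (slice s f r)) :=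
    tendsto_pi_nhds.2 fun ζ => hlim _ (smul_sphere_mem_unitBall hr ζ)
  have hunif := UniformFun.tendsto_iff_tendstoUniformly.1
    (((equicontinuous_slice hr hbs hF).tendsto_uniformFun_iff_pi U (slice s f r)).2 hpi)
  have hex : ∀ m : ℕ, ∃ x, ∀ ζ, dist (slice s f r ζ) (slice s (F x) r ζ) < 1 / (m + 1 : ℝ) :=
    fun m => (Metric.tendstoUniformly_iff.1 hunif _ Nat.one_div_pos_of_nat).exists
  choose x hx using hex
  have hseq : ∀ ζ, Tendsto (fun m => slice s (F (x m)) r ζ) atTop (𝓝 (slice s f r ζ)) := by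
    intro ζ
    rw [tendsto_iff_dist_tendsto_zero]
    refine squeeze_zero (fun _ => dist_nonneg) (fun m => ?_)
      tendsto_one_div_add_atTop_nhds_zero_nat
    rw [dist_comm]
    exact (hx m ζ).le
  refine (Lp.eLpNorm_lim_le_liminf_eLpNorm
    (fun m => (continuous_slice (hF (x m)) s hr).aestronglyMeasurable) _
    (Eventually.of_forall hseq)).trans ?_
  refine (liminf_le_liminf (v := fun _ => B) (Eventually.of_forall fun m => ?_)).trans_eq
    (liminf_const B)
  exact (eLpNorm_slice_le hp _ hr).trans (hB _)

end Limit

/-! ### Extension operators for finite and infinite families -/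

theorem InterpolatesMult.comp_injective {s : ℕ} {p C : ℝ} (hC : 0 ≤ C) {ι κ : Type}
    {a : ι → Cn n} (h : InterpolatesMult s p a C) {e : κ → ι} (he : Function.Injective e) :
    InterpolatesMult s p (a ∘ e) C := by
  intro μ
  have hle : ∀ i, ‖Function.extend e (μ : κ → ℂ) 0 i‖ ≤ ‖μ‖ := by
    intro i
    by_cases hi : ∃ k, e k = i
    · obtain ⟨k, rfl⟩ := hi
      rw [he.extend_apply]
      exact lp.norm_apply_le_norm ENNReal.top_ne_zero μ k
    · rw [Function.extend_apply' _ _ _ hi]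
      simp
  obtain ⟨m, hm, hma, hmC⟩ := h ⟨Function.extend e (μ : κ → ℂ) 0,
    memℓp_infty ⟨‖μ‖, by rintro _ ⟨i, rfl⟩; exact hle i⟩⟩
  refine ⟨m, hm, fun k => (hma (e k)).trans (he.extend_apply _ _ k), hmC.trans ?_⟩
  refine ENNReal.ofReal_le_ofReal (mul_le_mul_of_nonneg_left ?_ hC)
  exact lp.norm_le_of_forall_le (norm_nonneg _) hle

/-- Every finite subfamily has a linear extension operator, with a uniform bound on its norm. -/
theorem exists_finite_extension (hn : 1 ≤ n) (s : ℕ) {p C : ℝ} (hp : 1 ≤ p) (hC : 0 < C) :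
    ∃ K : ℝ, 0 < K ∧ ∀ (ι : Type) (a : ι → Cn n), (∀ i, a i ∈ unitBall n) →
      InterpolatesMult s p a C → ∀ t : Finset ι,
        ∃ T : lp (fun _ : ι => ℂ) (ENNReal.ofReal p) →ₗ[ℂ] (Cn n → ℂ), ∀ μ,
          MemHS s p (T μ) ∧ hsNorm s p (T μ) ≤ ENNReal.ofReal (K * ‖μ‖) ∧
          ∀ i ∈ t, T μ (a i) = μ i * (weight s p (a i) : ℂ) := by
  have hp0 : 0 < p := by linarith
  obtain ⟨A, hA, hpeak⟩ := exists_hsNorm_peak_le hn s hp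
  -- The exponent `l = s + 2` is admissible for every `p`, because `2p ≥ 2(p - 1)`.
  obtain ⟨K, hK, h⟩ := exists_forall_isCanonicalDual_hsNorm_sum_le hn s (s + 2) hp hC hA
    (by lia) (by push_cast; linarith)
  refine ⟨K, hK, fun ι a ha hint t => ?_⟩
  let e : Fin t.card → ι := fun k => (t.equivFin.symm k : ι)
  have he : Function.Injective e := Subtype.val_injective.comp t.equivFin.symm.injective
  obtain ⟨γ, hγ⟩ := exists_isCanonicalDual hC.le (hint.comp_injective hC.le he)
  have hT := h t.card (a ∘ e) γ (fun k => peak s p (a (e k))) hγ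
    (fun k => differentiableOn_peak s p (ha _)) (fun k => hpeak _ (ha _))
  refine ⟨{ toFun := fun μ z => ∑ k, μ (e k) * γ k z ^ (s + 2) * peak s p (a (e k)) z
            map_add' := fun μ ν => ?_
            map_smul' := fun c μ => ?_ }, fun μ => ⟨(hT _).1, (hT _).2.1.trans ?_, fun i hi => ?_⟩⟩
  · ext z
    simp only [lp.coeFn_add, Pi.add_apply, add_mul, Finset.sum_add_distrib]
  · ext z
    simp only [lp.coeFn_smul, Pi.smul_apply, smul_eq_mul, RingHom.id_apply, Finset.mul_sum,
      mul_assoc]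
  · refine ENNReal.ofReal_le_ofReal (mul_le_mul_of_nonneg_left ?_ hK.le)
    have h1 : ∑ k, ‖μ (e k)‖ ^ p = ∑ i ∈ t, ‖μ i‖ ^ p := by
      rw [← Finset.sum_coe_sort t fun i => ‖μ i‖ ^ p]
      exact Equiv.sum_comp t.equivFin.symm fun i : t => ‖μ i‖ ^ p
    have h2 := lp.sum_rpow_le_norm_rpow (p := ENNReal.ofReal p)
      (by rwa [ENNReal.toReal_ofReal hp0.le]) μ t
    rw [ENNReal.toReal_ofReal hp0.le] at h2
    rw [h1, one_div]
    exact (Real.rpow_inv_le_iff_of_pos (Finset.sum_nonneg fun i _ => by positivity)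
      (lp.norm_nonneg' μ) hp0).2 h2
  · have h1 := (hT fun k => μ (e k)).2.2 (t.equivFin ⟨i, hi⟩)
    have h2 : e (t.equivFin ⟨i, hi⟩) = i := by simp [e]
    simp only [Function.comp_apply, h2] at h1
    rw [← peak_self s p (ha i)]
    exact h1

/-- Limits along one fixed ultrafilter are linear in `μ`, unlike limits of subsequences chosen
separately for each `μ`. This gives a linear operator, not only solutions of the interpolation
problem. -/
theorem exists_hasExtensionOperator (hn : 1 ≤ n) (s : ℕ) {p C : ℝ} (hp : 1 ≤ p) (hC : 0 < C) :
    ∃ K : ℝ, 0 < K ∧ ∀ (ι : Type) (a : ι → Cn n), (∀ i, a i ∈ unitBall n) →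
      InterpolatesMult s p a C → HasExtensionOperator s p a K := by
  obtain ⟨K, hK, h⟩ := exists_finite_extension hn s hp hC
  refine ⟨K, hK, fun ι a ha hint => ?_⟩
  choose T hT using h ι a ha hint
  let U : Ultrafilter (Finset ι) := Ultrafilter.of atTop
  have hU : (U : Filter (Finset ι)) ≤ atTop := Ultrafilter.of_le atTop
  have hlb : ∀ μ, LocallyBounded fun t => T t μ := by
    intro μ r hr
    obtain ⟨E, hE, hev⟩ := exists_norm_le_mul_hsNorm hn s hp hr
    refine ⟨E * (ENNReal.ofReal (K * ‖μ‖)).toReal, fun t z hz => ?_⟩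
    refine (hev _ (hT t μ).1 z hz).trans ?_
    gcongr
    · exact ENNReal.ofReal_ne_top
    · exact (hT t μ).2.1
  -- Outside the ball there is no control on `T t μ`; the value `0` there keeps the limit linear at
  -- every point.
  have hex : ∀ μ, ∀ z, ∃ w : ℂ, (z ∈ unitBall n → Tendsto (fun t => T t μ z) U (𝓝 w)) ∧
      (z ∉ unitBall n → w = 0) := by
    intro μ z
    by_cases hz : z ∈ unitBall n
    · obtain ⟨M, hM⟩ := hlb μ ‖z‖ (mem_ball_zero_iff.1 hz)
      obtain ⟨w, -, hw⟩ := (isCompact_closedBall (0 : ℂ) M).ultrafilter_le_nhds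
        (U.map fun t => T t μ z) (le_principal_iff.2 (mem_map.2 (Eventually.of_forall fun t =>
          mem_closedBall_zero_iff.2 (hM t z (by simp)))))
      exact ⟨w, fun _ => hw, fun h => (h hz).elim⟩
    · exact ⟨0, fun h => (hz h).elim, fun _ => rfl⟩
  choose S hS hS0 using hex
  refine ⟨{ toFun := S
            map_add' := fun μ ν => ?_
            map_smul' := fun c μ => ?_ }, fun μ => ?_⟩
  · ext z
    by_cases hz : z ∈ unitBall n
    · refine tendsto_nhds_unique (hS (μ + ν) z hz) ?_
      simpa only [map_add, Pi.add_apply] using (hS μ z hz).add (hS ν z hz)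
    · simp [hS0 _ z hz]
  · ext z
    by_cases hz : z ∈ unitBall n
    · refine tendsto_nhds_unique (hS (c • μ) z hz) ?_
      simpa only [map_smul, Pi.smul_apply, RingHom.id_apply] using (hS μ z hz).const_smul c
    · simp [hS0 _ z hz]
  · have hd := fun t => (hT t μ).1.1
    have hle := hsNorm_le_of_tendsto U hp (hlb μ) hd (hS μ) fun t => (hT t μ).2.1
    refine ⟨⟨differentiableOn_of_tendsto U (hlb μ) hd (hS μ), hle.trans_lt ENNReal.ofReal_lt_top⟩,
      fun i => ?_, hle⟩
    refine tendsto_nhds_unique (hS μ (a i) (ha i)) (tendsto_const_nhds.congr' ?_)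
    -- The ultrafilter refines `atTop`, so almost every finite set contains `i` and interpolates
    -- exactly there.
    filter_upwards [hU (eventually_ge_atTop {i})] with t ht
    exact ((hT t μ).2.2 i (ht (Finset.mem_singleton_self i))).symm

theorem HasExtensionOperator.interpolatesHS {s : ℕ} {p K : ℝ} {ι : Type} {a : ι → Cn n}
    (h : HasExtensionOperator s p a K) : InterpolatesHS s p a K := by
  obtain ⟨T, hT⟩ := h
  exact fun μ => ⟨T μ, hT μ⟩

end HardySobolev

end

theorem mainTheorem1 (n : ℕ) (hn : 1 ≤ n) (s : ℕ) (p : ℝ) (hp : 1 ≤ p) (C : ℝ) (hC : 0 < C) :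
    (∀ l : ℕ, s < l → 2 * (p - 1) ≤ ((l : ℝ) - s) * p →
      ∃ K : ℝ, 0 < K ∧ ∀ (N : ℕ) (a : Fin N → HardySobolev.Cn n),
        (∀ k, a k ∈ HardySobolev.unitBall n) →
        HardySobolev.InterpolatesMult s p a C →
        (∃ γ, HardySobolev.IsCanonicalDual s p a C γ) ∧
        ∀ γ, HardySobolev.IsCanonicalDual s p a C γ → ∀ μ : Fin N → ℂ,
          HardySobolev.MemHS s p
            (fun z => ∑ k, μ k * γ k z ^ l * HardySobolev.normKernel s p (a k) z) ∧
          HardySobolev.hsNorm s p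
            (fun z => ∑ k, μ k * γ k z ^ l * HardySobolev.normKernel s p (a k) z) ≤
              ENNReal.ofReal (K * (∑ k, ‖μ k‖ ^ p) ^ (1 / p)) ∧
          ∀ i, ∑ k, μ k * γ k (a i) ^ l * HardySobolev.normKernel s p (a k) (a i) =
            μ i * HardySobolev.normKernel s p (a i) (a i)) ∧
    (∃ K : ℝ, 0 < K ∧ ∀ (ι : Type) (a : ι → HardySobolev.Cn n),
      (∀ i, a i ∈ HardySobolev.unitBall n) →
      HardySobolev.InterpolatesMult s p a C →
      HardySobolev.InterpolatesHS s p a K ∧ HardySobolev.HasExtensionOperator s p a K) := by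
  refine ⟨fun l hsl hl => ?_, ?_⟩
  · obtain ⟨K, hK, h⟩ := HardySobolev.exists_forall_isCanonicalDual_hsNorm_sum_le hn s l hp hC
      zero_le_one hsl hl
    refine ⟨K, hK, fun N a ha hint => ⟨HardySobolev.exists_isCanonicalDual hC.le hint,
      fun γ hγ μ => h N a γ (fun k => HardySobolev.normKernel s p (a k)) hγ
        (fun k => HardySobolev.differentiableOn_normKernel s p (ha k))
        (fun k => ?_) μ⟩⟩
    rw [ENNReal.ofReal_one]
    exact HardySobolev.hsNorm_normKernel_le hp (ha k)
  · obtain ⟨K, hK, h⟩ := HardySobolev.exists_hasExtensionOperator hn s hp hC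
    exact ⟨K, hK, fun ι a ha hint => ⟨(h ι a ha hint).interpolatesHS, h ι a ha hint⟩⟩
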